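/- Let $\mathbf{Top}$ be a locally presentable, cartesian closed full subcategory of the category of topological spaces which contains the disks $\mathbf{D}^n=\{b\in\mathbb{R}^n : |b|\le 1\}$ and the spheres $\mathbf{S}^{n-1}=\{b\in\mathbb{R}^n : |b|=1\}$ for all $n\ge 0$ (with $\mathbf{D}^0$ a point and $\mathbf{S}^{-1}=\varnothing$); for instance the $\Delta$-generated spaces, or the $\Delta$-Hausdorff $\Delta$-generated spaces. A flow is a small semicategory (category without identities) enriched over $(\mathbf{Top},\times)$; $\mathbf{Flow}$ is the category of flows and enriched semifunctors, and $\mathbf{Cat}$ is the category of small categories enriched over $(\mathbf{Top},\times)$ and enriched functors. Let $\mathbb{I}:\mathbf{Flow}\to\mathbf{Cat}$ be the left adjoint of the functor forgetting that identities exist: $\mathbb{I}$ adds to each state an identity map as an isolated point. A set is viewed as a flow without execution paths. For a space $Z$, let $\mathrm{Glob}(Z)$ be the flow with two states $0,1$, with $Z$ as the space of execution paths from $0$ to $1$, and with no other execution path. Let $$I^{gl}=\{\mathrm{Glob}(\mathbf{S}^{n-1})\subset \mathrm{Glob}(\mathbf{D}^{n}) \mid n\ge 0\},\qquad C:\varnothing\to\{0\}.$$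 For a class of maps $\mathcal{S}$, let $\mathrm{inj}(\mathcal{S})$ be the class of maps with the right lifting property with respect to $\mathcal{S}$, and $\mathrm{cof}(\mathcal{S})$ the class of maps with the left lifting property with respect to $\mathrm{inj}(\mathcal{S})$. Let $\mathcal{C}_{DK}=\mathrm{cof}(\mathbb{I}(I^{gl}\cup\{C\}))$ be the class of cofibrations of the Ilias model structure on $\mathbf{Cat}$, whose trivial fibrations form the class $\mathrm{inj}(\mathcal{C}_{DK})$. Then the left-lifting along $\mathbb{I}$ of the weak factorization system (cofibrations, trivial fibrations) of the Ilias model structure, i.e. the weak factorization system on $\mathbf{Flow}$ with left class $\mathbb{I}^{-1}(\mathcal{C}_{DK})$, exists and is small, being generated by the set $I^{gl}\cup\{C\}$. That is, $\mathbb{I}^{-1}(\mathcal{C}_{DK})=\mathrm{cof}(I^{gl}\cup\{C\})$, and $(\mathrm{cof}(I^{gl}\cup\{C\}),\mathrm{inj}(I^{gl}\cup\{C\}))$ is a weak factorization system on $\mathbf{Flow}$. -/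

import Mathlib

open CategoryTheory Limits MonoidalCategory CartesianMonoidalCategory

universe w v u

set_option linter.unusedSectionVars false
set_option linter.unusedSimpArgs false

noncomputable section

/-! ### Small semicategories and small categories enriched over `(V, ×)` -/

/-- A small semicategory (category without identities) enriched over a cartesian monoidal
category `V`. For `V` a convenient category of spaces this is a *flow*: `Obj` is the set of
states and `Path a b` is the space of execution paths from `a` to `b`. -/
structure EnrSemicat (V : Type u) [Category.{v} V] [CartesianMonoidalCategory V] where
  /-- The set of states. -/
  Obj : Type w
  /-- The space of execution paths from `a` to `b`. -/
  Path : Obj → Obj → V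
  /-- The composition `x * y` of an execution path `x` followed by `y`. -/
  comp (a b c : Obj) : Path a b ⊗ Path b c ⟶ Path a c
  assoc (a b c d : Obj) :
    comp a b c ▷ Path c d ≫ comp a c d =
      (α_ (Path a b) (Path b c) (Path c d)).hom ≫ Path a b ◁ comp b c d ≫ comp a b d

/-- A map of flows: an enriched semifunctor. -/
structure EnrSemifunctor {V : Type u} [Category.{v} V] [CartesianMonoidalCategory V]
    (X Y : EnrSemicat.{w} V) where
  /-- The map on states. -/
  obj : X.Obj → Y.Obj
  /-- The map on execution paths. -/
  map (a b : X.Obj) : X.Path a b ⟶ Y.Path (obj a) (obj b)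
  map_comp (a b c : X.Obj) :
    X.comp a b c ≫ map a c = (map a b ⊗ₘ map b c) ≫ Y.comp (obj a) (obj b) (obj c)

instance EnrSemicat.category (V : Type u) [Category.{v} V] [CartesianMonoidalCategory V] :
    Category (EnrSemicat.{w} V) where
  Hom X Y := EnrSemifunctor X Y
  id X := { obj := fun a => a, map := fun _ _ => 𝟙 _, map_comp := by simp }
  comp f g :=
    { obj := fun a => g.obj (f.obj a)
      map := fun a b => f.map a b ≫ g.map (f.obj a) (f.obj b)
      map_comp := by
        intro a b c
        rw [← Category.assoc, f.map_comp, Category.assoc, g.map_comp, ← Category.assoc,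
          ← MonoidalCategory.tensorHom_comp_tensorHom] }
  id_comp f := by cases f; simp
  comp_id f := by cases f; simp
  assoc f g h := by simp

/-- A small category enriched over `V`. -/
structure EnrCat (V : Type u) [Category.{v} V] [CartesianMonoidalCategory V] where
  /-- The set of objects. -/
  Obj : Type w
  /-- The enrichment. -/
  [str : EnrichedCategory V Obj]

attribute [instance] EnrCat.str

/-- The category of small categories enriched over `V`, the maps being the enriched functors. -/
instance EnrCat.category (V : Type u) [Category.{v} V] [CartesianMonoidalCategory V] :
    Category (EnrCat.{w} V) where
  Hom X Y := EnrichedFunctor V X.Obj Y.Obj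
  id X := EnrichedFunctor.id V X.Obj
  comp f g := EnrichedFunctor.comp V f g
  id_comp f := by cases f; simp [EnrichedFunctor.id, EnrichedFunctor.comp]
  comp_id f := by cases f; simp [EnrichedFunctor.id, EnrichedFunctor.comp]
  assoc f g h := by simp [EnrichedFunctor.comp]

theorem enrichedFunctor_ext {V : Type u} [Category.{v} V] [MonoidalCategory V] {C D : Type w}
    [EnrichedCategory V C] [EnrichedCategory V D] {F G : EnrichedFunctor V C D}
    (h₁ : F.obj = G.obj) (h₂ : HEq F.map G.map) : F = G := by
  cases F
  cases G
  cases h₁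
  cases h₂
  rfl

section Closed

variable {V : Type u} [Category.{v} V] [CartesianMonoidalCategory V] [MonoidalClosed V]

/-! ### Products with an initial object -/

/-- In a cartesian closed category, `A × B` is initial if `B` is. -/
def tensorRightInitial {A B : V} (t : IsInitial B) : IsInitial (A ⊗ B) :=
  t.ofIso (zeroMul t).symm

/-- In a cartesian closed category, `A × B` is initial if `A` is. -/
def tensorLeftInitial {A B : V} (t : IsInitial A) : IsInitial (A ⊗ B) :=
  (tensorRightInitial t : IsInitial (B ⊗ A)).ofIso
    { hom := lift (snd B A) (fst B A), inv := lift (snd A B) (fst A B) }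

variable [HasColimitsOfSize.{v, v} V]

/-! ### Sets and globes as flows -/

/-- `Z` if the proposition `p` holds, the initial object otherwise. -/
def copow (p : Prop) (Z : V) : V := ∐ fun _ : ULift.{v} (PLift p) => Z

/-- The canonical map `Z ⟶ copow p Z` (an isomorphism) if `p` holds. -/
def copow.ι {p : Prop} (h : p) (Z : V) : Z ⟶ copow p Z :=
  Sigma.ι (fun _ : ULift.{v} (PLift p) => Z) ⟨⟨h⟩⟩

/-- The map out of `copow p Z` given by a map out of `Z` in case `p` holds. -/
def copow.desc {p : Prop} {Z W : V} (f : p → (Z ⟶ W)) : copow p Z ⟶ W :=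
  Sigma.desc fun h : ULift.{v} (PLift p) => f h.down.down

theorem copow.ι_desc {p : Prop} {Z W : V} (f : p → (Z ⟶ W)) (h : p) :
    copow.ι h Z ≫ copow.desc f = f h := by
  exact Sigma.ι_desc (fun h : ULift.{v} (PLift p) => f h.down.down) ⟨⟨h⟩⟩

theorem copow.hom_ext {p : Prop} {Z W : V} {f g : copow p Z ⟶ W}
    (H : ∀ h : p, copow.ι h Z ≫ f = copow.ι h Z ≫ g) : f = g :=
  Sigma.hom_ext _ _ fun h => H h.down.down

/-- `copow p Z` is initial if `p` does not hold. -/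
def copow.isInitial {p : Prop} (h : ¬ p) (Z : V) : IsInitial (copow p Z) :=
  IsInitial.ofUniqueHom (fun _ => copow.desc fun hp => absurd hp h)
    fun _ _ => copow.hom_ext fun hp => absurd hp h

open Classical in
/-- `copow p Y × copow q Z` is initial if `p` and `q` exclude each other. -/
def copow.tensorIsInitial {p q : Prop} (h : ¬ (p ∧ q)) (Y Z : V) :
    IsInitial (copow p Y ⊗ copow q Z) :=
  if hp : p then tensorRightInitial (copow.isInitial (fun hq => h ⟨hp, hq⟩) Z)
  else tensorLeftInitial (copow.isInitial hp Y)

/-- A set viewed as a flow with an empty space of execution paths. -/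
def setFlow (V : Type u) [Category.{v} V] [CartesianMonoidalCategory V] [MonoidalClosed V]
    [HasColimitsOfSize.{v, v} V] (A : Type w) : EnrSemicat.{w} V where
  Obj := A
  Path _ _ := ⊥_ V
  comp _ _ _ := (tensorRightInitial initialIsInitial).to _
  assoc _ _ _ _ := (tensorRightInitial initialIsInitial).hom_ext _ _

/-- A map of sets viewed as a map of flows. -/
def setFlowMap (V : Type u) [Category.{v} V] [CartesianMonoidalCategory V] [MonoidalClosed V]
    [HasColimitsOfSize.{v, v} V] {A B : Type w} (f : A → B) : setFlow V A ⟶ setFlow V B where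
  obj := f
  map _ _ := 𝟙 _
  map_comp _ _ _ := (tensorRightInitial initialIsInitial).hom_ext _ _

theorem glob_excl (a b c : ULift.{w} (Fin 2)) :
    ¬ ((a.down = 0 ∧ b.down = 1) ∧ (b.down = 0 ∧ c.down = 1)) := by
  rintro ⟨⟨_, h⟩, ⟨h', _⟩⟩
  rw [h] at h'
  exact absurd h' (by decide)

/-- The globe `Glob(Z)`: two states `0` and `1`, the space `Z` as space of execution paths from
`0` to `1`, and no other execution path (hence no composition law). -/
def Glob (Z : V) : EnrSemicat.{w} V where
  Obj := ULift.{w} (Fin 2)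
  Path a b := copow (a.down = 0 ∧ b.down = 1) Z
  comp a b c := (copow.tensorIsInitial (glob_excl a b c) Z Z).to _
  assoc a b c _ := (tensorLeftInitial (copow.tensorIsInitial (glob_excl a b c) Z Z)).hom_ext _ _

/-- The map of flows `Glob(Y) ⟶ Glob(Z)` induced by a map `Y ⟶ Z`. -/
def Glob.map {Y Z : V} (f : Y ⟶ Z) : (Glob Y : EnrSemicat.{w} V) ⟶ Glob Z where
  obj a := a
  map _ _ := copow.desc fun h => f ≫ copow.ι h Z
  map_comp a b c := (copow.tensorIsInitial (glob_excl a b c) Y Y).hom_ext _ _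

/-! ### Adding identities to a flow -/

/-- The space of morphisms from `a` to `b` after adding identities: the coproduct of
`Path a b` with a point (the identity of `a`) if `a = b`, and `Path a b` otherwise. -/
def EnrSemicat.IdHom (X : EnrSemicat.{w} V) (a b : X.Obj) : V := copow (a = b) (𝟙_ V) ⨿ X.Path a b

namespace EnrSemicat

variable (X : EnrSemicat.{w} V)

/-- The added identity of `a`, seen from `a` to `b` if `a = b`. -/
def idι {a b : X.Obj} (h : a = b) : 𝟙_ V ⟶ X.IdHom a b := copow.ι h _ ≫ coprod.inl

/-- The inclusion of the execution paths. -/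
def pathι (a b : X.Obj) : X.Path a b ⟶ X.IdHom a b := coprod.inr

variable {X}

/-- Maps out of `IdHom a b`. -/
def idDesc {a b : X.Obj} {W : V} (f : a = b → (𝟙_ V ⟶ W)) (g : X.Path a b ⟶ W) :
    X.IdHom a b ⟶ W := coprod.desc (copow.desc f) g

theorem idι_idDesc {a b : X.Obj} {W : V} (f : a = b → (𝟙_ V ⟶ W)) (g : X.Path a b ⟶ W)
    (h : a = b) : X.idι h ≫ idDesc f g = f h := by
  exact (Category.assoc _ _ _).trans
    ((congrArg (copow.ι h _ ≫ ·) (coprod.inl_desc _ _)).trans (copow.ι_desc f h))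

theorem pathι_idDesc {a b : X.Obj} {W : V} (f : a = b → (𝟙_ V ⟶ W)) (g : X.Path a b ⟶ W) :
    X.pathι a b ≫ idDesc f g = g :=
  coprod.inr_desc _ _

theorem id_hom_ext {a b : X.Obj} {W : V} {f g : X.IdHom a b ⟶ W}
    (h₁ : ∀ h : a = b, X.idι h ≫ f = X.idι h ≫ g)
    (h₂ : X.pathι a b ≫ f = X.pathι a b ≫ g) : f = g :=
  coprod.hom_ext (copow.hom_ext fun h =>
    (Category.assoc _ _ _).symm.trans ((h₁ h).trans (Category.assoc _ _ _))) h₂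

/-- Maps out of `A × IdHom a b`. -/
def idDescRight {a b : X.Obj} {A W : V} (f : a = b → (A ⟶ W)) (g : A ⊗ X.Path a b ⟶ W) :
    A ⊗ X.IdHom a b ⟶ W :=
  MonoidalClosed.uncurry
    (idDesc (fun h => MonoidalClosed.curry (fst A (𝟙_ V) ≫ f h)) (MonoidalClosed.curry g))

/-- Maps out of `IdHom a b × A`. -/
def idDescLeft {a b : X.Obj} {A W : V} (f : a = b → (A ⟶ W)) (g : X.Path a b ⊗ A ⟶ W) :
    X.IdHom a b ⊗ A ⟶ W :=
  lift (snd _ _) (fst _ _) ≫ idDescRight f (lift (snd _ _) (fst _ _) ≫ g)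

theorem idι_idDescRight {a b : X.Obj} {A W : V} (f : a = b → (A ⟶ W))
    (g : A ⊗ X.Path a b ⟶ W) (h : a = b) :
    A ◁ X.idι h ≫ idDescRight f g = fst _ _ ≫ f h := by
  rw [idDescRight, ← MonoidalClosed.uncurry_natural_left, idι_idDesc,
    MonoidalClosed.uncurry_curry]

theorem pathι_idDescRight {a b : X.Obj} {A W : V} (f : a = b → (A ⟶ W))
    (g : A ⊗ X.Path a b ⟶ W) : A ◁ X.pathι a b ≫ idDescRight f g = g := by
  rw [idDescRight, ← MonoidalClosed.uncurry_natural_left, pathι_idDesc,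
    MonoidalClosed.uncurry_curry]

theorem swap_whisker {A B C : V} (f : B ⟶ C) :
    f ▷ A ≫ lift (snd C A) (fst C A) = lift (snd B A) (fst B A) ≫ A ◁ f := by
  ext <;> simp

theorem swap_whiskerLeft {A B C W : V} (f : B ⟶ C) (g : C ⊗ A ⟶ W) :
    A ◁ f ≫ lift (snd A C) (fst A C) ≫ g = lift (snd A B) (fst A B) ≫ f ▷ A ≫ g := by
  simp only [← Category.assoc]
  congr 1
  ext <;> simp

theorem swap_swap {A B W : V} (f : A ⊗ B ⟶ W) :
    lift (snd A B) (fst A B) ≫ lift (snd B A) (fst B A) ≫ f = f := by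
  rw [← Category.assoc]
  convert Category.id_comp f
  ext <;> simp

theorem idι_idDescLeft {a b : X.Obj} {A W : V} (f : a = b → (A ⟶ W))
    (g : X.Path a b ⊗ A ⟶ W) (h : a = b) :
    X.idι h ▷ A ≫ idDescLeft f g = snd _ _ ≫ f h := by
  rw [idDescLeft, ← Category.assoc, swap_whisker, Category.assoc, idι_idDescRight,
    ← Category.assoc, lift_fst]

theorem pathι_idDescLeft {a b : X.Obj} {A W : V} (f : a = b → (A ⟶ W))
    (g : X.Path a b ⊗ A ⟶ W) : X.pathι a b ▷ A ≫ idDescLeft f g = g := by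
  rw [idDescLeft, ← Category.assoc, swap_whisker, Category.assoc, pathι_idDescRight, swap_swap]

theorem id_hom_ext_right {a b : X.Obj} {A W : V} {f g : A ⊗ X.IdHom a b ⟶ W}
    (h₁ : ∀ h : a = b, A ◁ X.idι h ≫ f = A ◁ X.idι h ≫ g)
    (h₂ : A ◁ X.pathι a b ≫ f = A ◁ X.pathι a b ≫ g) : f = g := by
  apply MonoidalClosed.curry_injective
  apply id_hom_ext
  · intro h
    rw [← MonoidalClosed.curry_natural_left, ← MonoidalClosed.curry_natural_left, h₁ h]
  · rw [← MonoidalClosed.curry_natural_left, ← MonoidalClosed.curry_natural_left, h₂]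

theorem id_hom_ext_left {a b : X.Obj} {A W : V} {f g : X.IdHom a b ⊗ A ⟶ W}
    (h₁ : ∀ h : a = b, X.idι h ▷ A ≫ f = X.idι h ▷ A ≫ g)
    (h₂ : X.pathι a b ▷ A ≫ f = X.pathι a b ▷ A ≫ g) : f = g := by
  rw [← swap_swap f, ← swap_swap g]
  congr 1
  apply id_hom_ext_right
  · intro h
    rw [swap_whiskerLeft, swap_whiskerLeft, h₁ h]
  · rw [swap_whiskerLeft, swap_whiskerLeft, h₂]

variable (X)

/-- The composition after adding identities: the added identities are neutral, and execution
paths are composed as in `X`. -/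
def idComp (a b c : X.Obj) : X.IdHom a b ⊗ X.IdHom b c ⟶ X.IdHom a c :=
  idDescLeft (fun h => eqToHom (by rw [h]))
    (idDescRight (fun h => X.pathι a b ≫ eqToHom (by rw [h])) (X.comp a b c ≫ X.pathι a c))

theorem lift_idι_idComp {T : V} {a b : X.Obj} (h : a = b) {c : X.Obj} (g : T ⟶ X.IdHom b c) :
    lift (toUnit T ≫ X.idι h) g ≫ X.idComp a b c = g ≫ eqToHom (by rw [h]) := by
  have : lift (toUnit T ≫ X.idι h) g = lift (toUnit T) g ≫ X.idι h ▷ _ := by simp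
  rw [this, Category.assoc, idComp, idι_idDescLeft, lift_snd_assoc]

theorem lift_pathι_idι_idComp {T : V} (a : X.Obj) {b c : X.Obj} (h : b = c)
    (g : T ⟶ X.Path a b) :
    lift (g ≫ X.pathι a b) (toUnit T ≫ X.idι h) ≫ X.idComp a b c =
      g ≫ X.pathι a b ≫ eqToHom (by rw [h]) := by
  have : lift (g ≫ X.pathι a b) (toUnit T ≫ X.idι h) =
    lift g (toUnit T) ≫ _ ◁ X.idι h ≫ X.pathι a b ▷ _ := by simp
  rw [this, Category.assoc, Category.assoc, idComp, pathι_idDescLeft, idι_idDescRight,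
    lift_fst_assoc]

theorem lift_idComp_idι {T : V} (a : X.Obj) {b c : X.Obj} (h : b = c) (g : T ⟶ X.IdHom a b) :
    lift g (toUnit T ≫ X.idι h) ≫ X.idComp a b c = g ≫ eqToHom (by rw [h]) := by
  have key : lift (𝟙 _) (toUnit _ ≫ X.idι h) ≫ X.idComp a b c = eqToHom (by rw [h]) := by
    apply id_hom_ext
    · intro h'
      have e : X.idι h' ≫ lift (𝟙 _) (toUnit _ ≫ X.idι h) =
          lift (toUnit _ ≫ X.idι h') (X.idι h) := by
        ext <;> simp [toUnit_unique (toUnit _) (𝟙 (𝟙_ V))]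
      rw [← Category.assoc, e, lift_idι_idComp]
      cases h'
      cases h
      simp
    · have e : X.pathι a b ≫ lift (𝟙 _) (toUnit _ ≫ X.idι h) =
          lift (𝟙 _ ≫ X.pathι a b) (toUnit _ ≫ X.idι h) := by
        ext <;> simp
      rw [← Category.assoc, e, lift_pathι_idι_idComp, Category.id_comp]
  rw [← key, ← Category.assoc]
  congr 1
  ext <;> simp

theorem lift_pathι_idComp {T : V} (a b c : X.Obj) (f : T ⟶ X.Path a b) (g : T ⟶ X.Path b c) :
    lift (f ≫ X.pathι a b) (g ≫ X.pathι b c) ≫ X.idComp a b c =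
      lift f g ≫ X.comp a b c ≫ X.pathι a c := by
  have : lift (f ≫ X.pathι a b) (g ≫ X.pathι b c) =
    lift f g ≫ _ ◁ X.pathι b c ≫ X.pathι a b ▷ _ := by simp
  rw [this, Category.assoc, Category.assoc, idComp, pathι_idDescLeft, pathι_idDescRight]

theorem id_hom_ext_mid {a b : X.Obj} {A B W : V} {f g : A ⊗ (X.IdHom a b ⊗ B) ⟶ W}
    (h₁ : ∀ h : a = b, A ◁ (X.idι h ▷ B) ≫ f = A ◁ (X.idι h ▷ B) ≫ g)
    (h₂ : A ◁ (X.pathι a b ▷ B) ≫ f = A ◁ (X.pathι a b ▷ B) ≫ g) : f = g := by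
  apply MonoidalClosed.curry_injective
  apply id_hom_ext_left
  · intro h
    rw [← MonoidalClosed.curry_natural_left, ← MonoidalClosed.curry_natural_left, h₁ h]
  · rw [← MonoidalClosed.curry_natural_left, ← MonoidalClosed.curry_natural_left, h₂]

theorem id_hom_ext_end {a b : X.Obj} {A B W : V} {f g : A ⊗ (B ⊗ X.IdHom a b) ⟶ W}
    (h₁ : ∀ h : a = b, A ◁ (B ◁ X.idι h) ≫ f = A ◁ (B ◁ X.idι h) ≫ g)
    (h₂ : A ◁ (B ◁ X.pathι a b) ≫ f = A ◁ (B ◁ X.pathι a b) ≫ g) : f = g := by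
  apply MonoidalClosed.curry_injective
  apply id_hom_ext_right
  · intro h
    rw [← MonoidalClosed.curry_natural_left, ← MonoidalClosed.curry_natural_left, h₁ h]
  · rw [← MonoidalClosed.curry_natural_left, ← MonoidalClosed.curry_natural_left, h₂]

theorem lift_comp_assoc {T : V} {a b c d : X.Obj} (f : T ⟶ X.Path a b) (g : T ⟶ X.Path b c)
    (h : T ⟶ X.Path c d) :
    lift (lift f g ≫ X.comp a b c) h ≫ X.comp a c d =
      lift f (lift g h ≫ X.comp b c d) ≫ X.comp a b d := by
  have := congrArg (lift (lift f g) h ≫ ·) (X.assoc a b c d)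
  simpa using this

theorem idComp_assoc (a b c d : X.Obj) :
    (α_ (X.IdHom a b) (X.IdHom b c) (X.IdHom c d)).inv ≫
        X.idComp a b c ▷ X.IdHom c d ≫ X.idComp a c d =
      X.IdHom a b ◁ X.idComp b c d ≫ X.idComp a b d := by
  have e₁ : (α_ (X.IdHom a b) (X.IdHom b c) (X.IdHom c d)).inv ≫ X.idComp a b c ▷ X.IdHom c d =
      lift (lift (fst _ _) (snd _ _ ≫ fst _ _) ≫ X.idComp a b c) (snd _ _ ≫ snd _ _) := by
    ext
    · simp only [Category.assoc, whiskerRight_fst, lift_fst]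
      rw [← Category.assoc]
      congr 1
      ext <;> simp
    · simp
  have e₂ : X.IdHom a b ◁ X.idComp b c d =
      lift (fst _ _) (lift (snd _ _ ≫ fst _ _) (snd _ _ ≫ snd _ _) ≫ X.idComp b c d) := by
    ext
    · simp
    · simp only [whiskerLeft_snd, lift_snd]
      congr 1
      ext <;> simp
  rw [← Category.assoc, e₁, e₂]
  apply id_hom_ext_left
  · intro h
    simp only [comp_lift_assoc, comp_lift, whiskerRight_fst, whiskerRight_snd_assoc]
    simp only [toUnit_unique (fst (𝟙_ V) _) (toUnit _), lift_idι_idComp]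
    cases h
    simp
  simp only [comp_lift_assoc, comp_lift, whiskerRight_fst, whiskerRight_snd_assoc]
  apply id_hom_ext_mid
  · intro h
    cases h
    simp only [comp_lift_assoc, comp_lift, whiskerLeft_fst_assoc, whiskerLeft_snd_assoc,
      whiskerRight_fst, whiskerRight_snd]
    simp only [toUnit_unique (fst (𝟙_ V) _) (toUnit _), comp_toUnit_assoc, lift_idι_idComp,
      lift_pathι_idι_idComp, eqToHom_refl, Category.comp_id]
  simp only [comp_lift_assoc, comp_lift, whiskerLeft_fst_assoc, whiskerLeft_snd_assoc,
      whiskerRight_fst, whiskerRight_snd]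
  apply id_hom_ext_end
  · intro h
    cases h
    simp only [comp_lift_assoc, comp_lift, whiskerLeft_fst_assoc, whiskerLeft_snd_assoc,
      whiskerLeft_fst, whiskerLeft_snd]
    simp only [toUnit_unique (snd _ (𝟙_ V)) (toUnit _), comp_toUnit_assoc, lift_idComp_idι,
      eqToHom_refl, Category.comp_id]
  simp only [comp_lift_assoc, comp_lift, whiskerLeft_fst_assoc, whiskerLeft_snd_assoc,
      whiskerLeft_fst, whiskerLeft_snd]
  simp only [← Category.assoc (snd _ _), lift_pathι_idComp]
  simp only [← Category.assoc (lift _ _), lift_pathι_idComp]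
  rw [lift_comp_assoc]

/-- The enriched category obtained from `X` by adding identities as isolated points. -/
def addIdObj : EnrCat.{w} V where
  Obj := X.Obj
  str :=
    { Hom := X.IdHom
      id := fun a => X.idι (rfl : a = a)
      comp := X.idComp
      id_comp := fun a b => by
        have e : (λ_ (X.IdHom a b)).inv ≫ X.idι (rfl : a = a) ▷ X.IdHom a b =
            lift (toUnit _ ≫ X.idι rfl) (𝟙 _) := by ext <;> simp
        rw [← Category.assoc, e, lift_idι_idComp]
        simp
      comp_id := fun a b => by
        have e : (ρ_ (X.IdHom a b)).inv ≫ X.IdHom a b ◁ X.idι (rfl : b = b) =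
            lift (𝟙 _) (toUnit _ ≫ X.idι rfl) := by ext <;> simp
        rw [← Category.assoc, e, lift_idComp_idι]
        simp
      assoc := X.idComp_assoc }

variable {X} {Y : EnrSemicat.{w} V}

/-- The map induced on `IdHom` by a map of flows. -/
def idMap (f : EnrSemifunctor X Y) (a b : X.Obj) :
    X.IdHom a b ⟶ Y.IdHom (f.obj a) (f.obj b) :=
  idDesc (fun h => Y.idι (congrArg f.obj h)) (f.map a b ≫ Y.pathι (f.obj a) (f.obj b))

theorem idι_idMap (f : EnrSemifunctor X Y) {a b : X.Obj} (h : a = b) :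
    X.idι h ≫ idMap f a b = Y.idι (congrArg f.obj h) :=
  idι_idDesc _ _ h

theorem pathι_idMap (f : EnrSemifunctor X Y) (a b : X.Obj) :
    X.pathι a b ≫ idMap f a b = f.map a b ≫ Y.pathι (f.obj a) (f.obj b) :=
  pathι_idDesc _ _

theorem idComp_idMap (f : EnrSemifunctor X Y) (a b c : X.Obj) :
    X.idComp a b c ≫ idMap f a c =
      (idMap f a b ⊗ₘ idMap f b c) ≫ Y.idComp (f.obj a) (f.obj b) (f.obj c) := by
  have e : ∀ {T : V} (x : T ⟶ X.IdHom a b) (y : T ⟶ X.IdHom b c),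
      lift x y ≫ (idMap f a b ⊗ₘ idMap f b c) =
        lift (x ≫ idMap f a b) (y ≫ idMap f b c) := fun x y => by simp
  have e₁ : ∀ {A B C : V} (x : A ⟶ B), x ▷ C = lift (fst _ _ ≫ x) (snd _ _) := fun x => by
    ext <;> simp
  have e₂ : ∀ {A B C D : V} (x : A ⟶ B) (y : C ⟶ D),
      C ◁ x ≫ y ▷ B = lift (fst _ _ ≫ y) (snd _ _ ≫ x) := fun x y => by
    ext <;> simp
  apply id_hom_ext_left
  · intro h
    rw [e₁, toUnit_unique (fst (𝟙_ V) _) (toUnit _), ← Category.assoc, ← Category.assoc, e,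
      Category.assoc (toUnit _), idι_idMap, lift_idι_idComp, lift_idι_idComp]
    cases h
    simp
  apply id_hom_ext_right
  · intro h
    rw [← Category.assoc, ← Category.assoc (_ ◁ _), e₂, toUnit_unique (snd _ (𝟙_ V)) (toUnit _),
      ← Category.assoc, ← Category.assoc, e, Category.assoc (toUnit _), idι_idMap,
      lift_idComp_idι, lift_idComp_idι]
    cases h
    simp
  · rw [← Category.assoc, ← Category.assoc (_ ◁ _), e₂, ← Category.assoc, ← Category.assoc, e,
      lift_pathι_idComp, Category.assoc, Category.assoc, Category.assoc, Category.assoc,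
      pathι_idMap, pathι_idMap, pathι_idMap, ← Category.assoc (fst _ _),
      ← Category.assoc (snd _ _),
      lift_pathι_idComp, ← Category.assoc (X.comp a b c), f.map_comp]
    simp

theorem idMap_id (a b : X.Obj) : idMap (𝟙 X : X ⟶ X) a b = 𝟙 (X.IdHom a b) :=
  id_hom_ext
    (fun h => (idι_idMap (𝟙 X : X ⟶ X) h).trans (Category.comp_id (X.idι h)).symm)
    ((pathι_idMap (𝟙 X : X ⟶ X) a b).trans
      ((Category.id_comp (X.pathι a b)).trans (Category.comp_id (X.pathι a b)).symm))

theorem idMap_comp {Z : EnrSemicat.{w} V} (f : X ⟶ Y) (g : Y ⟶ Z) (a b : X.Obj) :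
    idMap (f ≫ g) a b = idMap f a b ≫ idMap g (f.obj a) (f.obj b) := by
  apply id_hom_ext
  · intro h
    rw [← Category.assoc, idι_idMap f h, idι_idMap g]
    exact idι_idMap (f ≫ g) h
  · rw [← Category.assoc, pathι_idMap f, Category.assoc, pathι_idMap g, ← Category.assoc]
    exact pathι_idMap (f ≫ g) a b

end EnrSemicat

open EnrSemicat in
/-- The functor `𝕀` from flows to enriched small categories, adding an identity to every state
as an isolated point. It is left adjoint to the functor forgetting the identities. -/
def addId (V : Type u) [Category.{v} V] [CartesianMonoidalCategory V] [MonoidalClosed V]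
    [HasColimitsOfSize.{v, v} V] : EnrSemicat.{w} V ⥤ EnrCat.{w} V where
  obj X := X.addIdObj
  map f :=
    { obj := f.obj
      map := idMap f
      map_id := fun a => idι_idMap f (rfl : a = a)
      map_comp := idComp_idMap f }
  map_id _ := enrichedFunctor_ext rfl <| heq_of_eq <| funext fun a => funext fun b => idMap_id a b
  map_comp f g := enrichedFunctor_ext rfl <| heq_of_eq <| funext fun a => funext fun b =>
    idMap_comp f g a b

end Closed

/-! ### The generating cofibrations -/

/-- A locally presentable category is cocomplete. -/
instance hasColimitsOfLocallyPresentable (V : Type u) [Category.{v} V]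
    [h : IsLocallyPresentable.{v} V] : HasColimitsOfSize.{v, v} V := by
  obtain ⟨κ, _, _⟩ := h.exists_cardinal
  infer_instance

section Generators

open TopCat

variable (P : ObjectProperty TopCat.{u}) [CartesianMonoidalCategory P.FullSubcategory]
  [MonoidalClosed P.FullSubcategory] [IsLocallyPresentable.{u} P.FullSubcategory]
  (hS : ∀ n, P (∂𝔻 n)) (hD : ∀ n, P (𝔻 n))

/-- The inclusion of `S^{n-1}` in `D^n`, in the full subcategory of spaces satisfying `P`. -/
def sphereIncl (n : ℕ) :
    (⟨∂𝔻 n, hS n⟩ : P.FullSubcategory) ⟶ (⟨𝔻 n, hD n⟩ : P.FullSubcategory) :=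
  ObjectProperty.homMk (diskBoundaryInclusion n)

/-- The set of maps of flows `I^gl = {Glob(S^{n-1}) ⊂ Glob(D^n) | n ≥ 0}`. -/
def Igl : MorphismProperty (EnrSemicat.{u} P.FullSubcategory) :=
  MorphismProperty.ofHoms fun n : ℕ => Glob.map (sphereIncl P hS hD n)

/-- The map of flows `C : ∅ ⟶ {0}`. -/
def mapC : setFlow P.FullSubcategory PEmpty.{u + 1} ⟶ setFlow P.FullSubcategory PUnit.{u + 1} :=
  setFlowMap P.FullSubcategory fun a : PEmpty.{u + 1} => a.elim

/-- The set of maps of flows `I^gl ∪ {C}`. -/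
def IglC : MorphismProperty (EnrSemicat.{u} P.FullSubcategory) :=
  Igl P hS hD ⊔ MorphismProperty.ofHoms fun _ : Unit => mapC P

/-- The cofibrations of the Ilias model structure on enriched small categories: the class
`cof(𝕀(I^gl ∪ {C}))` of maps with the left lifting property with respect to all the maps with
the right lifting property with respect to `𝕀(I^gl ∪ {C})`. The trivial fibrations are
`(iliasCof P hS hD).rlp`. -/
def iliasCof : MorphismProperty (EnrCat.{u} P.FullSubcategory) :=
  ((IglC P hS hD).strictMap (addId P.FullSubcategory)).rlp.llp

end Generators

/-- The left-lifting along `F : C ⥤ D` of a weak factorization system with left class `L`: a weak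
factorization system `(L', R')` on `C` whose left class is `F⁻¹(L)`. -/
structure IsLeftLifting {C D : Type*} [Category* C] [Category* D] (F : C ⥤ D)
    (L : MorphismProperty D) (L' R' : MorphismProperty C) : Prop where
  left_eq : L' = L.inverseImage F
  isWeakFactorizationSystem : L'.IsWeakFactorizationSystem R'

end

/-! ### Lifting properties of maps of flows, on states and on paths -/

noncomputable section

/-! A map of flows has the right lifting property for `IglC` exactly when it is surjective on states
and each of its maps of path spaces lifts against all sphere inclusions. Two things are then needed:
the equality of the two left classes, and a factorization.

Equality of the left classes. One inclusion is formal from the adjunction `addIdAdjunction`. For the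
other, let `addId` send `f` to a cofibration. Lifting against codiscrete categories shows that `f`
is injective on states (`injective_of_iliasCof`). The functor `addId` does not preserve all trivial
fibrations: if `p` identifies two distinct states `a` and `b`, the identity of their common image
has no lift from `a` to `b`. But it preserves those that are injective on states, because disks are
connected: a disk in the coproduct of a path space and an isolated identity lies in one summand
(`idMap_hasLiftingProperty`). In a square from `f` to a trivial fibration `p`, a lift on states
exists since `f` is injective and `p` surjective. Pulling `p` back along it (`pullMap`) yields a
trivial fibration that is the identity on states. Once identities are added, `f` lifts against it,
and the lift sends paths to paths because it lies over a map that does, so it restricts to flows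
(`hasLiftingProperty_of_addId`).

Factorization. The small object argument is run in diagram categories rather than in flows. To
factor `X ⟶ Y`, first adjoin the states of `Y` freely to those of `X`; from then on the set of
states `S` is fixed. A flow on `S` is encoded by its `nerve`, the diagram of strings of one, two or
three composable paths, and flows correspond to diagrams satisfying a Segal condition. The cells of
`flowCells` attach the generators on edges and also enforce unique fillers of triangles and fillers
of tetrahedra. Factoring the map from the diagram generated by `X` (a left Kan extension) to the
nerve of `Y` gives a middle diagram that is Segal because it is so relative to a nerve; it is
therefore a flow, and the lifting properties transfer back (`exists_factorization`). -/

theorem copow.desc_comp {V : Type u} [Category.{v} V] [CartesianMonoidalCategory V]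
    [MonoidalClosed V] [HasColimitsOfSize.{v, v} V] {p : Prop}
    {Z W W' : V} (f : p → (Z ⟶ W)) (g : W ⟶ W') :
    copow.desc f ≫ g = copow.desc fun h => f h ≫ g := by
  refine copow.hom_ext fun h => ?_
  rw [← Category.assoc, copow.ι_desc, copow.ι_desc]

theorem copow.map_desc {V : Type u} [Category.{v} V] [CartesianMonoidalCategory V]
    [MonoidalClosed V] [HasColimitsOfSize.{v, v} V] {p : Prop}
    {Y Z W : V} (i : Y ⟶ Z) (f : p → (Z ⟶ W)) :
    copow.desc (fun h => i ≫ copow.ι h Z) ≫ copow.desc f = copow.desc fun h => i ≫ f h := by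
  refine copow.hom_ext fun h => ?_
  rw [← Category.assoc, copow.ι_desc, copow.ι_desc, Category.assoc, copow.ι_desc]

namespace EnrSemicat

section Basic

variable {V : Type u} [Category.{v} V] [CartesianMonoidalCategory V]

/-- Both maps share the same function on states, so the path components can be compared without
transport along an equality of states. -/
theorem hom_ext' {X Y : EnrSemicat.{w} V} {o : X.Obj → Y.Obj}
    {m m' : ∀ a b, X.Path a b ⟶ Y.Path (o a) (o b)} {c c'}
    (h : ∀ a b, m a b = m' a b) :
    (⟨o, m, c⟩ : EnrSemifunctor X Y) = ⟨o, m', c'⟩ := by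
  obtain rfl : m = m' := funext fun a => funext fun b => h a b
  rfl

theorem map_eq_of_eq {X Y : EnrSemicat.{w} V} {o : X.Obj → Y.Obj}
    {m m' : ∀ a b, X.Path a b ⟶ Y.Path (o a) (o b)} {c c'}
    (h : (⟨o, m, c⟩ : EnrSemifunctor X Y) = ⟨o, m', c'⟩) (a b : X.Obj) : m a b = m' a b := by
  cases h
  rfl

theorem obj_eq_of_eq {X Y : EnrSemicat.{w} V} {f g : X ⟶ Y} (h : f = g) : f.obj = g.obj := by
  rw [h]

/-- The flow with set of states `S` whose paths are those of `A` between the images of the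
states. -/
@[reducible]
def pull (A : EnrSemicat.{w} V) {S : Type w} (h : S → A.Obj) : EnrSemicat.{w} V where
  Obj := S
  Path a b := A.Path (h a) (h b)
  comp a b c := A.comp (h a) (h b) (h c)
  assoc a b c d := A.assoc (h a) (h b) (h c) (h d)

/-- The restriction of a map of flows to flows with states in a given set. -/
def pullMap {A B : EnrSemicat.{w} V} (p : A ⟶ B) {S : Type w} (h : S → A.Obj) :
    A.pull h ⟶ B.pull (fun s => p.obj (h s)) where
  obj s := s
  map a b := p.map (h a) (h b)
  map_comp a b c := p.map_comp (h a) (h b) (h c)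

/-- The canonical map from a restricted flow. -/
def pullι (A : EnrSemicat.{w} V) {S : Type w} (h : S → A.Obj) : A.pull h ⟶ A where
  obj := h
  map _ _ := 𝟙 _
  map_comp a b c := by simp only [Category.comp_id, id_tensorHom_id, Category.id_comp]

/-- If `f` is injective on states and `p` is surjective on states, lifting properties may be
checked on the squares together with a lift on states. -/
theorem hasLiftingProperty_of_obj {X Y A B : EnrSemicat.{w} V} (f : X ⟶ Y)
    (hf : Function.Injective f.obj) (p : A ⟶ B) (hp : Function.Surjective p.obj)
    (H : ∀ (h : Y.Obj → A.Obj) (um : ∀ a b, X.Path a b ⟶ A.Path (h (f.obj a)) (h (f.obj b))) (uc)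
      (vm : ∀ a b, Y.Path a b ⟶ B.Path (p.obj (h a)) (p.obj (h b))) (vc),
      (∀ a b, um a b ≫ p.map _ _ = f.map a b ≫ vm _ _) →
      ∃ (l : Y ⟶ A), f ≫ l = (⟨fun a => h (f.obj a), um, uc⟩ : EnrSemifunctor X A) ∧
        l ≫ p = (⟨fun a => p.obj (h a), vm, vc⟩ : EnrSemifunctor Y B)) :
    HasLiftingProperty f p := by
  constructor
  rintro ⟨uo, um, uc⟩ ⟨vo, vm, vc⟩ ⟨sq⟩
  have ho : ∀ x, p.obj (uo x) = vo (f.obj x) := fun x => congrFun (obj_eq_of_eq sq) x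
  obtain ⟨h, h₁, h₂⟩ : ∃ h : Y.Obj → A.Obj, (fun x => h (f.obj x)) = uo ∧
      (fun y => p.obj (h y)) = vo := by
    -- On the image of `f` the value is forced by `uo`, and well defined by injectivity; elsewhere
    -- any preimage under `p` will do.
    have : ∀ y, ∃ a, p.obj a = vo y ∧ ∀ x, f.obj x = y → a = uo x := by
      intro y
      by_cases hy : ∃ x, f.obj x = y
      · obtain ⟨x, rfl⟩ := hy
        exact ⟨uo x, ho x, fun x' hx' => by rw [hf hx']⟩
      · obtain ⟨a, ha⟩ := hp (vo y)
        exact ⟨a, ha, fun x hx => absurd ⟨x, hx⟩ hy⟩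
    choose h hh using this
    exact ⟨h, funext fun x => (hh _).2 x rfl, funext fun y => (hh y).1⟩
  -- After substitution the state parts of the square are literally `h ∘ f` and `p ∘ h`, so the
  -- condition left on paths involves no transport.
  subst h₁
  subst h₂
  obtain ⟨l, hl₁, hl₂⟩ := H h um uc vm vc fun a b => map_eq_of_eq sq a b
  exact ⟨⟨⟨l, hl₁, hl₂⟩⟩⟩

end Basic

section Closed

variable {V : Type u} [Category.{v} V] [CartesianMonoidalCategory V] [MonoidalClosed V]
  [HasColimitsOfSize.{v, v} V]

/-- The map out of a globe given by maps to spaces of execution paths. -/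
def globDesc {Z : V} {A : EnrSemicat.{w} V} (o : ULift.{w} (Fin 2) → A.Obj)
    (z : ∀ x y, x.down = 0 ∧ y.down = 1 → (Z ⟶ A.Path (o x) (o y))) :
    (Glob Z : EnrSemicat.{w} V) ⟶ A where
  obj := o
  map x y := copow.desc (z x y)
  map_comp a b c := (copow.tensorIsInitial (glob_excl a b c) Z Z).hom_ext _ _

theorem exists_eq_globDesc {Z : V} {A : EnrSemicat.{w} V} (u : (Glob Z : EnrSemicat.{w} V) ⟶ A) :
    ∃ o z, u = globDesc o z := by
  obtain ⟨uo, um, uc⟩ := u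
  refine ⟨uo, fun x y h => copow.ι h Z ≫ um x y, hom_ext' fun x y => copow.hom_ext fun h => ?_⟩
  exact (copow.ι_desc (fun h => copow.ι h Z ≫ um x y) h).symm

theorem globDesc_congr {Z : V} {A : EnrSemicat.{w} V} {o : ULift.{w} (Fin 2) → A.Obj}
    {z z' : ∀ x y, x.down = 0 ∧ y.down = 1 → (Z ⟶ A.Path (o x) (o y))}
    (H : (globDesc o z : (Glob Z : EnrSemicat.{w} V) ⟶ A) = globDesc o z') : z = z' := by
  funext x y h
  have := map_eq_of_eq H x y
  rw [← copow.ι_desc (z x y) h, this]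
  exact copow.ι_desc (z' x y) h

theorem map_globDesc {Y Z : V} (i : Y ⟶ Z) {A : EnrSemicat.{w} V}
    (o : ULift.{w} (Fin 2) → A.Obj)
    (z : ∀ x y, x.down = 0 ∧ y.down = 1 → (Z ⟶ A.Path (o x) (o y))) :
    Glob.map i ≫ globDesc o z = globDesc o fun x y h => i ≫ z x y h := by
  exact hom_ext' (X := Glob Y) (o := o) fun x y => copow.map_desc i (z x y)

theorem globDesc_comp {Z : V} {A B : EnrSemicat.{w} V} (o : ULift.{w} (Fin 2) → A.Obj)
    (z : ∀ x y, x.down = 0 ∧ y.down = 1 → (Z ⟶ A.Path (o x) (o y))) (q : A ⟶ B) :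
    globDesc o z ≫ q = globDesc (fun x => q.obj (o x)) fun x y h => z x y h ≫ q.map _ _ := by
  exact hom_ext' (X := Glob Z) (o := fun x : ULift.{w} (Fin 2) => q.obj (o x))
    fun x y => copow.desc_comp (z x y) (q.map _ _)

theorem glob_hasLiftingProperty {Y Z : V} (i : Y ⟶ Z) {A B : EnrSemicat.{w} V} (q : A ⟶ B)
    (H : ∀ a b, HasLiftingProperty i (q.map a b)) :
    HasLiftingProperty (Glob.map i : (Glob Y : EnrSemicat.{w} V) ⟶ Glob Z) q := by
  constructor
  rintro u v ⟨sq⟩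
  obtain ⟨o, y, rfl⟩ := exists_eq_globDesc u
  obtain ⟨o', z, rfl⟩ := exists_eq_globDesc v
  rw [map_globDesc, globDesc_comp] at sq
  obtain rfl : (fun x => q.obj (o x)) = o' := obj_eq_of_eq sq
  have sq' : ∀ (a b : ULift.{w} (Fin 2)) (h : a.down = 0 ∧ b.down = 1),
      CommSq (y a b h) i (q.map (o a) (o b)) (z a b h) :=
    fun a b h => ⟨congrFun (congrFun (congrFun (globDesc_congr sq) a) b) h⟩
  refine ⟨⟨⟨globDesc o fun a b h => (sq' a b h).lift, ?_, ?_⟩⟩⟩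
  · rw [map_globDesc]
    simp only [CommSq.fac_left]
  · rw [globDesc_comp]
    simp only [CommSq.fac_right]

theorem path_hasLiftingProperty {Y Z : V} (i : Y ⟶ Z) {A B : EnrSemicat.{w} V} (q : A ⟶ B)
    (H : HasLiftingProperty (Glob.map i : (Glob Y : EnrSemicat.{w} V) ⟶ Glob Z) q)
    (a b : A.Obj) : HasLiftingProperty i (q.map a b) := by
  constructor
  intro y z ⟨sq⟩
  let o : ULift.{w} (Fin 2) → A.Obj := fun x => if x.down = 0 then a else b
  have ho : ∀ x y : ULift.{w} (Fin 2), x.down = 0 ∧ y.down = 1 → a = o x ∧ b = o y := by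
    rintro ⟨x⟩ ⟨y⟩ ⟨rfl, rfl⟩
    exact ⟨rfl, rfl⟩
  have hsq : CommSq
      -- The casts record that `o` takes the values `a` and `b` at the two ends; they reduce to
      -- identities when evaluated at the states `0` and `1`.
      (globDesc o fun c d h => y ≫ eqToHom (by rw [← (ho c d h).1, ← (ho c d h).2]))
      (Glob.map i : (Glob Y : EnrSemicat.{w} V) ⟶ Glob Z) q
      (globDesc (fun x => q.obj (o x)) fun c d h =>
        z ≫ eqToHom (by rw [← (ho c d h).1, ← (ho c d h).2])) := by
    refine ⟨?_⟩
    rw [map_globDesc, globDesc_comp]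
    congr 1
    funext c d h
    obtain ⟨hc, hd⟩ := ho c d h
    generalize o c = c', o d = d' at hc hd
    subst hc hd
    simpa using sq
  obtain ⟨⟨l, hl, hl'⟩⟩ := H.sq_hasLift hsq
  obtain ⟨o', l, rfl⟩ := exists_eq_globDesc l
  rw [map_globDesc] at hl
  rw [globDesc_comp] at hl'
  obtain rfl : o' = o := obj_eq_of_eq hl
  have h01 : (⟨0⟩ : ULift.{w} (Fin 2)).down = 0 ∧ (⟨1⟩ : ULift.{w} (Fin 2)).down = 1 := ⟨rfl, rfl⟩
  have e₁ := congrFun (congrFun (congrFun (globDesc_congr hl) ⟨0⟩) ⟨1⟩) h01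
  have e₂ := congrFun (congrFun (congrFun (globDesc_congr hl') ⟨0⟩) ⟨1⟩) h01
  exact ⟨⟨⟨l ⟨0⟩ ⟨1⟩ h01, e₁.trans (Category.comp_id _), e₂.trans (Category.comp_id _)⟩⟩⟩

theorem hasLiftingProperty_glob_iff {Y Z : V} (i : Y ⟶ Z) {A B : EnrSemicat.{w} V} (q : A ⟶ B) :
    HasLiftingProperty (Glob.map i : (Glob Y : EnrSemicat.{w} V) ⟶ Glob Z) q ↔
      ∀ a b, HasLiftingProperty i (q.map a b) :=
  ⟨path_hasLiftingProperty i q, glob_hasLiftingProperty i q⟩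

/-- Maps out of a set viewed as a flow. -/
def setFlowDesc {S : Type w} {A : EnrSemicat.{w} V} (o : S → A.Obj) : setFlow V S ⟶ A where
  obj := o
  map _ _ := initial.to _
  map_comp _ _ _ := (tensorRightInitial initialIsInitial).hom_ext _ _

theorem setFlow_hom_ext {S : Type w} {A : EnrSemicat.{w} V} {f g : setFlow V S ⟶ A}
    (h : f.obj = g.obj) : f = g := by
  obtain ⟨fo, fm, fc⟩ := f
  obtain ⟨go, gm, gc⟩ := g
  obtain rfl : fo = go := h
  exact hom_ext' fun _ _ => initialIsInitial.hom_ext _ _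

theorem hasLiftingProperty_setFlow_iff {A B : EnrSemicat.{w} V} (q : A ⟶ B) :
    HasLiftingProperty (setFlowMap V fun a : PEmpty.{w + 1} => (a.elim : PUnit.{w + 1})) q ↔
      Function.Surjective q.obj := by
  constructor
  · intro H b
    have sq : CommSq (setFlowDesc fun a : PEmpty.{w + 1} => (a.elim : A.Obj))
        (setFlowMap V fun a : PEmpty.{w + 1} => (a.elim : PUnit.{w + 1})) q
        (setFlowDesc fun _ : PUnit.{w + 1} => b) :=
      ⟨setFlow_hom_ext (funext fun a : PEmpty => a.elim)⟩
    obtain ⟨⟨l, hl, hl'⟩⟩ := H.sq_hasLift sq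
    exact ⟨l.obj PUnit.unit, congrFun (obj_eq_of_eq hl') PUnit.unit⟩
  · intro hq
    constructor
    intro u v sq
    obtain ⟨a, ha⟩ := hq (v.obj PUnit.unit)
    exact ⟨⟨⟨setFlowDesc fun _ : PUnit.{w + 1} => a,
      setFlow_hom_ext (funext fun a : PEmpty => a.elim),
      setFlow_hom_ext (funext fun _ : PUnit.{w + 1} => ha)⟩⟩⟩

end Closed

end EnrSemicat

section Generators

variable (P : ObjectProperty TopCat.{u}) [CartesianMonoidalCategory P.FullSubcategory]
  [MonoidalClosed P.FullSubcategory] [IsLocallyPresentable.{u} P.FullSubcategory]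
  (hS : ∀ n, P (TopCat.diskBoundary n)) (hD : ∀ n, P (TopCat.disk n))

/-- The condition on states and the conditions on the individual path spaces are independent. Hence
restricting the states of a trivial fibration, as `pullMap` does, gives a trivial fibration again.
-/
theorem rlp_IglC_iff {A B : EnrSemicat.{u} P.FullSubcategory} (q : A ⟶ B) :
    (IglC P hS hD).rlp q ↔ Function.Surjective q.obj ∧
      ∀ n a b, HasLiftingProperty (sphereIncl P hS hD n) (q.map a b) := by
  constructor
  · intro h
    refine ⟨(EnrSemicat.hasLiftingProperty_setFlow_iff q).1 (h _ (Or.inr ⟨()⟩)), fun n => ?_⟩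
    exact (EnrSemicat.hasLiftingProperty_glob_iff _ q).1 (h _ (Or.inl ⟨n⟩))
  · rintro ⟨h₁, h₂⟩ _ _ _ (⟨⟨n⟩⟩ | ⟨⟨⟩⟩)
    · exact (EnrSemicat.hasLiftingProperty_glob_iff _ q).2 (h₂ n)
    · exact (EnrSemicat.hasLiftingProperty_setFlow_iff q).2 h₁

end Generators

end

/-! ### The adjunction between adding and forgetting identities -/

noncomputable section

/-- The flow underlying an enriched category, forgetting that identities exist. -/
@[reducible]
def EnrCat.toSemicat {V : Type u} [Category.{v} V] [CartesianMonoidalCategory V]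
    (C : EnrCat.{w} V) : EnrSemicat.{w} V where
  Obj := C.Obj
  Path a b := EnrichedCategory.Hom a b
  comp a b c := eComp V a b c
  assoc a b c d := by
    rw [← e_assoc, Iso.hom_inv_id_assoc]

/-- The functor forgetting the identities. -/
def forgetId (V : Type u) [Category.{v} V] [CartesianMonoidalCategory V] :
    EnrCat.{w} V ⥤ EnrSemicat.{w} V where
  obj C := C.toSemicat
  map {C D} F := (⟨F.obj, F.map, fun a b c => F.map_comp a b c⟩ :
    EnrSemifunctor C.toSemicat D.toSemicat)
  map_id _ := rfl
  map_comp _ _ := rfl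

section Adjunction

variable {V : Type u} [Category.{v} V] [CartesianMonoidalCategory V] [MonoidalClosed V]
  [HasColimitsOfSize.{v, v} V]

open EnrSemicat

/-- The map on `IdHom` induced by a map of flows to an enriched category. -/
def EnrSemicat.idExtend {X : EnrSemicat.{w} V} {C : EnrCat.{w} V}
    (f : EnrSemifunctor X C.toSemicat) (a b : X.Obj) :
    X.IdHom a b ⟶ EnrichedCategory.Hom (V := V) (C := C.Obj) (f.obj a) (f.obj b) :=
  idDesc (fun h => eId V (f.obj a) ≫ eqToHom (by rw [h])) (f.map a b)

theorem EnrCat.lift_eId_eComp {C : EnrCat.{w} V} {T : V} (x y : C.Obj)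
    (g : T ⟶ EnrichedCategory.Hom (V := V) x y) :
    lift (toUnit T ≫ eId V x) g ≫ eComp V x x y = g := by
  have e : lift (toUnit T ≫ eId V x) g = g ≫ (λ_ _).inv ≫ eId V x ▷ _ := by ext <;> simp
  rw [e, Category.assoc, Category.assoc, e_id_comp, Category.comp_id]

theorem EnrCat.lift_eComp_eId {C : EnrCat.{w} V} {T : V} (x y : C.Obj)
    (g : T ⟶ EnrichedCategory.Hom (V := V) x y) :
    lift g (toUnit T ≫ eId V y) ≫ eComp V x y y = g := by
  have e : lift g (toUnit T ≫ eId V y) = g ≫ (ρ_ _).inv ≫ _ ◁ eId V y := by ext <;> simp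
  rw [e, Category.assoc, Category.assoc, e_comp_id, Category.comp_id]

theorem EnrSemicat.idι_idExtend {X : EnrSemicat.{w} V} {C : EnrCat.{w} V}
    (f : EnrSemifunctor X C.toSemicat) (a : X.Obj) :
    X.idι (rfl : a = a) ≫ idExtend f a a = eId V (C := C.Obj) (f.obj a) :=
  (idι_idDesc _ _ _).trans (Category.comp_id _)

theorem EnrSemicat.pathι_idExtend {X : EnrSemicat.{w} V} {C : EnrCat.{w} V}
    (f : EnrSemifunctor X C.toSemicat) (a b : X.Obj) :
    X.pathι a b ≫ idExtend f a b = f.map a b :=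
  pathι_idDesc _ _

/-- By cartesian closedness, products distribute over the coproduct defining `IdHom`, so the
identity may be checked on summands: the unit laws of `C` settle those involving an identity, and
`f.map_comp` settles the remaining one. -/
theorem EnrSemicat.idComp_idExtend {X : EnrSemicat.{w} V} {C : EnrCat.{w} V}
    (f : EnrSemifunctor X C.toSemicat) (a b c : X.Obj) :
    X.idComp a b c ≫ idExtend f a c =
      (idExtend f a b ⊗ₘ idExtend f b c) ≫ eComp V (C := C.Obj) (f.obj a) (f.obj b) (f.obj c) := by
  have e : ∀ {T : V} (x : T ⟶ X.IdHom a b) (y : T ⟶ X.IdHom b c),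
      lift x y ≫ (idExtend f a b ⊗ₘ idExtend f b c) =
        lift (x ≫ idExtend f a b) (y ≫ idExtend f b c) := fun x y => by simp
  have e₁ : ∀ {A B C : V} (x : A ⟶ B), x ▷ C = lift (fst _ _ ≫ x) (snd _ _) := fun x => by
    ext <;> simp
  have e₂ : ∀ {A B C D : V} (x : A ⟶ B) (y : C ⟶ D),
      C ◁ x ≫ y ▷ B = lift (fst _ _ ≫ y) (snd _ _ ≫ x) := fun x y => by
    ext <;> simp
  apply id_hom_ext_left
  · intro h
    rw [e₁, toUnit_unique (fst (𝟙_ V) _) (toUnit _), ← Category.assoc, ← Category.assoc, e,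
      Category.assoc (toUnit _), lift_idι_idComp]
    cases h
    rw [idι_idExtend, EnrCat.lift_eId_eComp]
    simp
  apply id_hom_ext_right
  · intro h
    rw [← Category.assoc, ← Category.assoc (_ ◁ _), e₂, toUnit_unique (snd _ (𝟙_ V)) (toUnit _),
      ← Category.assoc, ← Category.assoc, e, Category.assoc (toUnit _), lift_idComp_idι]
    cases h
    rw [idι_idExtend, EnrCat.lift_eComp_eId]
    simp
  · rw [← Category.assoc, ← Category.assoc (_ ◁ _), e₂, ← Category.assoc, ← Category.assoc, e,
      lift_pathι_idComp, Category.assoc, Category.assoc, Category.assoc, Category.assoc,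
      pathι_idExtend, pathι_idExtend, pathι_idExtend, f.map_comp]
    simp [tensorHom_def']

theorem EnrSemicat.pathι_tensor_idComp (X : EnrSemicat.{w} V) (a b c : X.Obj) :
    (X.pathι a b ⊗ₘ X.pathι b c) ≫ X.idComp a b c = X.comp a b c ≫ X.pathι a c := by
  have := X.lift_pathι_idComp a b c (fst _ _) (snd _ _)
  rw [lift_fst_snd, Category.id_comp] at this
  rw [← this]
  congr 1
  ext <;> simp

theorem EnrSemicat.comp_pathι_comp (X : EnrSemicat.{w} V) {a b c : X.Obj} {A B C : V}
    {f : X.IdHom a b ⟶ A} {g : X.IdHom b c ⟶ B} {h : X.IdHom a c ⟶ C} {m : A ⊗ B ⟶ C}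
    (H : X.idComp a b c ≫ h = (f ⊗ₘ g) ≫ m) :
    X.comp a b c ≫ X.pathι a c ≫ h = (X.pathι a b ≫ f ⊗ₘ X.pathι b c ≫ g) ≫ m := by
  rw [← Category.assoc, ← pathι_tensor_idComp, Category.assoc, ← tensorHom_comp_tensorHom,
    Category.assoc, H]

/-- The map of flows underlying an enriched functor out of `X.addIdObj`. -/
def EnrSemicat.idRestrict {X : EnrSemicat.{w} V} {C : EnrCat.{w} V}
    (F : EnrichedFunctor V X.addIdObj.Obj C.Obj) : EnrSemifunctor X C.toSemicat where
  obj := F.obj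
  map a b := X.pathι a b ≫ F.map a b
  map_comp a b c := X.comp_pathι_comp (F.map_comp a b c)

theorem EnrSemicat.idExtend_idRestrict {X : EnrSemicat.{w} V} {C : EnrCat.{w} V}
    (F : EnrichedFunctor V X.addIdObj.Obj C.Obj) (a b : X.Obj) :
    idExtend (idRestrict F) a b = F.map a b := by
  apply id_hom_ext
  · intro h
    cases h
    rw [idι_idExtend]
    exact (F.map_id a).symm
  · exact pathι_idExtend _ a b

theorem EnrSemicat.idExtend_comp {X Y : EnrSemicat.{w} V} {C : EnrCat.{w} V} (f : X ⟶ Y)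
    (g : Y ⟶ C.toSemicat) (a b : X.Obj) :
    idExtend (f ≫ g) a b = idMap f a b ≫ idExtend g (f.obj a) (f.obj b) := by
  apply id_hom_ext
  · intro h
    cases h
    rw [idι_idExtend, ← Category.assoc, idι_idMap]
    exact (idι_idExtend g (f.obj a)).symm
  · rw [pathι_idExtend, ← Category.assoc, pathι_idMap, Category.assoc, pathι_idExtend]
    rfl

/-- The functor adding identities is left adjoint to the functor forgetting the identities. -/
def addIdAdjunction (V : Type u) [Category.{v} V] [CartesianMonoidalCategory V]
    [MonoidalClosed V] [HasColimitsOfSize.{v, v} V] :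
    addId.{w} V ⊣ forgetId.{w} V :=
  Adjunction.mkOfHomEquiv
    { homEquiv := fun X C =>
        { toFun := fun F => idRestrict F
          invFun := fun f => (⟨f.obj, idExtend f, idι_idExtend f, idComp_idExtend f⟩ :
            EnrichedFunctor V X.addIdObj.Obj C.Obj)
          left_inv := fun F => enrichedFunctor_ext rfl <| heq_of_eq <| funext fun a =>
            funext fun b => idExtend_idRestrict F a b
          right_inv := fun f => hom_ext' fun a b => pathι_idExtend f a b }
      homEquiv_naturality_left_symm := fun f g => enrichedFunctor_ext rfl <| heq_of_eq <|
        funext fun a => funext fun b => idExtend_comp f g a b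
      homEquiv_naturality_right := fun {X _ D} f g => hom_ext' (X := X) (Y := D.toSemicat)
        (o := fun a => g.obj (f.obj a)) fun a b => (Category.assoc (X.pathι a b)
          (f.map a b) (g.map (f.obj a) (f.obj b))).symm }

theorem hasLiftingProperty_addId_iff {X Y : EnrSemicat.{w} V} (i : X ⟶ Y) {C D : EnrCat.{w} V}
    (q : C ⟶ D) : HasLiftingProperty ((addId V).map i) q ↔
      HasLiftingProperty i ((forgetId V).map q) :=
  (addIdAdjunction V).hasLiftingProperty_iff i q

/-- The right lifting property with respect to the image of a class under `addId`. -/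
theorem rlp_strictMap_addId_iff (W : MorphismProperty (EnrSemicat.{w} V)) {C D : EnrCat.{w} V}
    (q : C ⟶ D) : (W.strictMap (addId V)).rlp q ↔ W.rlp ((forgetId V).map q) := by
  constructor
  · intro h _ _ i hi
    exact (hasLiftingProperty_addId_iff i q).1 (h _ ⟨hi⟩)
  · rintro h _ _ _ ⟨hi⟩
    exact (hasLiftingProperty_addId_iff _ q).2 (h _ hi)

/-- The formal half of the equality of left classes: forgetting identities turns trivial fibrations
of enriched categories into trivial fibrations of flows, so lifting problems transpose along the
adjunction. -/
theorem llp_rlp_le_inverseImage_addId (W : MorphismProperty (EnrSemicat.{w} V)) :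
    W.rlp.llp ≤ (W.strictMap (addId V)).rlp.llp.inverseImage (addId V) := by
  intro X Y f hf C D q hq
  exact (hasLiftingProperty_addId_iff f q).2 (hf _ ((rlp_strictMap_addId_iff W q).1 hq))

end Adjunction

end

/-! ### Separating the added identities from the execution paths -/

noncomputable section

/-- An object with two distinct points such that maps out of it may be prescribed on the two
points. -/
structure TwoPointObject (V : Type u) [Category.{v} V] [CartesianMonoidalCategory V] where
  /-- The object. -/
  pt : V
  /-- The first point. -/
  e₀ : 𝟙_ V ⟶ pt
  /-- The second point. -/
  e₁ : 𝟙_ V ⟶ pt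
  ne : e₀ ≠ e₁
  exists_desc {Q : V} (q₀ q₁ : 𝟙_ V ⟶ Q) : ∃ d : pt ⟶ Q, e₀ ≫ d = q₀ ∧ e₁ ≫ d = q₁

/-- Every object without points is initial. -/
def PointlessIsInitial (V : Type u) [Category.{v} V] [CartesianMonoidalCategory V] : Prop :=
  ∀ K : V, Nonempty (𝟙_ V ⟶ K) ∨ Nonempty (IsInitial K)

section

variable {V : Type u} [Category.{v} V] [CartesianMonoidalCategory V] [MonoidalClosed V]

/-- Currying gives definition by cases on `E.pt` with a parameter in `A`. The two equations are
stated on generalized elements, the form in which they are used. -/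
theorem TwoPointObject.exists_tensor_desc (E : TwoPointObject V) {A W : V} (g₀ g₁ : A ⟶ W) :
    ∃ h : A ⊗ E.pt ⟶ W, (∀ {T : V} (x : T ⟶ A), lift x (toUnit T ≫ E.e₀) ≫ h = x ≫ g₀) ∧
      ∀ {T : V} (x : T ⟶ A), lift x (toUnit T ≫ E.e₁) ≫ h = x ≫ g₁ := by
  obtain ⟨d, h₀, h₁⟩ := E.exists_desc (MonoidalClosed.curry (fst A (𝟙_ V) ≫ g₀))
    (MonoidalClosed.curry (fst A (𝟙_ V) ≫ g₁))
  have key : ∀ (e : 𝟙_ V ⟶ E.pt) (g : A ⟶ W), e ≫ d = MonoidalClosed.curry (fst A (𝟙_ V) ≫ g) →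
      ∀ {T : V} (x : T ⟶ A), lift x (toUnit T ≫ e) ≫ MonoidalClosed.uncurry d = x ≫ g := by
    intro e g he T x
    have e' : lift x (toUnit T ≫ e) = lift x (toUnit T) ≫ A ◁ e := by ext <;> simp
    rw [e', Category.assoc, ← MonoidalClosed.uncurry_natural_left, he,
      MonoidalClosed.uncurry_curry, lift_fst_assoc]
  exact ⟨MonoidalClosed.uncurry d, key _ _ h₀, key _ _ h₁⟩

variable [HasColimitsOfSize.{v, v} V]

namespace EnrSemicat

variable (E : TwoPointObject V) {X : EnrSemicat.{w} V}

/-- The map separating the added identities from the execution paths. -/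
def idIndicator (X : EnrSemicat.{w} V) (a b : X.Obj) : X.IdHom a b ⟶ E.pt :=
  idDesc (fun _ => E.e₀) (toUnit _ ≫ E.e₁)

theorem idι_idIndicator {a b : X.Obj} (h : a = b) : X.idι h ≫ idIndicator E X a b = E.e₀ :=
  idι_idDesc _ _ h

theorem pathι_idIndicator (a b : X.Obj) :
    X.pathι a b ≫ idIndicator E X a b = toUnit _ ≫ E.e₁ :=
  pathι_idDesc _ _

theorem idMap_idIndicator {Y : EnrSemicat.{w} V} (f : EnrSemifunctor X Y) (a b : X.Obj) :
    idMap f a b ≫ idIndicator E Y (f.obj a) (f.obj b) = idIndicator E X a b := by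
  apply id_hom_ext
  · intro h
    rw [← Category.assoc, idι_idMap, idι_idIndicator, idι_idIndicator]
  · rw [← Category.assoc, pathι_idMap, Category.assoc, pathι_idIndicator, pathι_idIndicator,
      comp_toUnit_assoc]

/-- The endomorphism of `IdHom a b` that is constant at the identity where the indicator is `e₀`,
and does nothing where it is `e₁`, is the identity map. Applied to `g`, it shows that `g` is
constant. -/
theorem eq_idι_of_idIndicator {a b : X.Obj} (h : a = b) {K : V} (g : K ⟶ X.IdHom a b)
    (hg : g ≫ idIndicator E X a b = toUnit K ≫ E.e₀) : g = toUnit K ≫ X.idι h := by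
  obtain ⟨d, h₀, h₁⟩ := E.exists_tensor_desc (toUnit (X.IdHom a b) ≫ X.idι h) (𝟙 _)
  -- Checked on summands: an added identity is fixed by the first branch, a path by the second.
  have key : lift (𝟙 _) (idIndicator E X a b) ≫ d = 𝟙 _ := by
    apply id_hom_ext
    · intro h'
      rw [comp_lift_assoc, idι_idIndicator, Category.comp_id]
      have := h₀ (X.idι h')
      rw [toUnit_unique (toUnit (𝟙_ V)) (𝟙 _), Category.id_comp] at this
      rw [this, ← Category.assoc, toUnit_unique (_ ≫ _) (𝟙 (𝟙_ V)), Category.id_comp]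
    · rw [comp_lift_assoc, pathι_idIndicator, Category.comp_id, h₁, Category.comp_id]
  rw [← Category.comp_id g, ← key, comp_lift_assoc, hg, Category.comp_id, h₀, comp_toUnit_assoc]

/-- For `a ≠ b` there is no identity summand, so the indicator is constant at `e₁`. -/
theorem eq_of_idIndicator {a b : X.Obj} (g : 𝟙_ V ⟶ X.IdHom a b)
    (hg : g ≫ idIndicator E X a b = E.e₀) : a = b := by
  by_contra h
  have : idIndicator E X a b = toUnit _ ≫ E.e₁ := by
    apply id_hom_ext
    · exact fun h' => absurd h' h
    · rw [pathι_idIndicator, comp_toUnit_assoc]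
  rw [this, ← Category.assoc, toUnit_unique (_ ≫ _) (𝟙 (𝟙_ V)), Category.id_comp] at hg
  exact E.ne hg.symm

theorem pathι_idDesc_id {a b : X.Obj} (x : 𝟙_ V ⟶ X.Path a b) :
    X.pathι a b ≫ idDesc (fun _ => x) (𝟙 _) = 𝟙 _ :=
  pathι_idDesc _ _

/-- If `K` has a point, so does the path object, and sending the added identity to that point gives
a retraction of `pathι`. Otherwise `K` is initial. -/
theorem pathι_cancel (hV : PointlessIsInitial V) {a b : X.Obj} {K : V} {x y : K ⟶ X.Path a b}
    (h : x ≫ X.pathι a b = y ≫ X.pathι a b) : x = y := by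
  obtain ⟨⟨k⟩⟩ | ⟨⟨hK⟩⟩ := hV K
  · rw [← Category.comp_id x, ← Category.comp_id y, ← pathι_idDesc_id (k ≫ x), ← Category.assoc,
      ← Category.assoc, h]
  · exact hK.hom_ext _ _

/-- With a point `x` of the path object, the retraction of `pathι` that sends identities to `x` is
composed with `g`; nothing is lost, as `g` meets no identity. Without such a point the path object
is initial, the indicator is constant at `e₀`, and `K` can have no point either. -/
theorem exists_comp_pathι (hV : PointlessIsInitial V) {a b : X.Obj} {K : V} (g : K ⟶ X.IdHom a b)
    (hg : g ≫ idIndicator E X a b = toUnit K ≫ E.e₁) :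
    ∃ g' : K ⟶ X.Path a b, g' ≫ X.pathι a b = g := by
  obtain ⟨⟨x⟩⟩ | ⟨⟨hP⟩⟩ := hV (X.Path a b)
  -- The branch at `e₁` is retraction followed by inclusion, which fixes the paths; the branch at
  -- `e₀` fixes the identities.
  · obtain ⟨d, h₀, h₁⟩ := E.exists_tensor_desc (𝟙 _)
      (idDesc (fun _ => x) (𝟙 _) ≫ X.pathι a b)
    have key : lift (𝟙 _) (idIndicator E X a b) ≫ d = 𝟙 _ := by
      apply id_hom_ext
      · intro h'
        rw [comp_lift_assoc, idι_idIndicator, Category.comp_id]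
        have := h₀ (X.idι h')
        rw [toUnit_unique (toUnit (𝟙_ V)) (𝟙 _), Category.id_comp] at this
        rw [this, Category.comp_id]
      · rw [comp_lift_assoc, pathι_idIndicator, Category.comp_id, h₁, ← Category.assoc,
          pathι_idDesc_id, Category.id_comp]
    refine ⟨g ≫ idDesc (fun _ => x) (𝟙 _), ?_⟩
    rw [Category.assoc, ← h₁, ← hg]
    conv_lhs => rw [← Category.comp_id g, Category.assoc, Category.id_comp, ← comp_lift_assoc, key,
      Category.comp_id]
  · obtain ⟨⟨k⟩⟩ | ⟨⟨hK⟩⟩ := hV K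
    · exfalso
      have : idIndicator E X a b = toUnit _ ≫ E.e₀ := by
        apply id_hom_ext
        · intro h
          rw [idι_idIndicator, ← Category.assoc, toUnit_unique (_ ≫ _) (𝟙 (𝟙_ V)),
            Category.id_comp]
        · exact hP.hom_ext _ _
      have h' := congrArg (k ≫ ·) hg
      simp only [this, comp_toUnit_assoc] at h'
      rw [toUnit_unique (toUnit _) (𝟙 (𝟙_ V)), Category.id_comp, Category.id_comp] at h'
      exact E.ne h'
    · exact ⟨hK.to _, hK.hom_ext _ _⟩

/-- As `D` is connected, the lower map of a square lands in the identities or in the paths, and the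
upper map follows suit. In the first case the lift is constant at an identity, which exists between
`a` and `b` only because `q` is injective on states; in the second the square restricts to paths. -/
theorem idMap_hasLiftingProperty (hV : PointlessIsInitial V) {S D : V} (i : S ⟶ D) (d : 𝟙_ V ⟶ D)
    (hD : ∀ c : D ⟶ E.pt, c = toUnit D ≫ E.e₀ ∨ c = toUnit D ≫ E.e₁) {A B : EnrSemicat.{w} V}
    (q : A ⟶ B) (hq : Function.Injective q.obj) (a b : A.Obj)
    (H : HasLiftingProperty i (q.map a b)) : HasLiftingProperty i (idMap q a b) := by
  constructor
  intro x y ⟨sq⟩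
  have hx : x ≫ idIndicator E A a b = i ≫ y ≫ idIndicator E B (q.obj a) (q.obj b) := by
    rw [← idMap_idIndicator E q, ← Category.assoc, sq, Category.assoc]
  obtain hy | hy := hD (y ≫ idIndicator E B (q.obj a) (q.obj b))
  · have hab : a = b := hq <| eq_of_idIndicator E (d ≫ y) <| by
      rw [Category.assoc, hy, ← Category.assoc, toUnit_unique (_ ≫ _) (𝟙 (𝟙_ V)),
        Category.id_comp]
    rw [hy, comp_toUnit_assoc] at hx
    refine ⟨⟨⟨toUnit D ≫ A.idι hab, ?_, ?_⟩⟩⟩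
    · rw [comp_toUnit_assoc, ← eq_idι_of_idIndicator E hab x hx]
    · rw [Category.assoc, idι_idMap, ← eq_idι_of_idIndicator E (congrArg q.obj hab) y hy]
  · rw [hy, comp_toUnit_assoc] at hx
    obtain ⟨x', rfl⟩ := exists_comp_pathι E hV x hx
    obtain ⟨y', rfl⟩ := exists_comp_pathι E hV y hy
    have sq' : CommSq x' i (q.map a b) y' := ⟨pathι_cancel hV <| by
      rw [Category.assoc, ← pathι_idMap, Category.assoc, ← sq, Category.assoc]⟩
    refine ⟨⟨⟨sq'.lift ≫ A.pathι a b, ?_, ?_⟩⟩⟩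
    · rw [← Category.assoc, sq'.fac_left]
    · rw [Category.assoc, pathι_idMap, ← Category.assoc, sq'.fac_right]

/-- A family compatible with the indicators sends paths to paths; multiplicativity then restricts
because `pathι` can be cancelled. -/
theorem exists_semifunctor_of_idIndicator (hV : PointlessIsInitial V)
    {Y A : EnrSemicat.{w} V} {o : Y.Obj → A.Obj}
    (m : ∀ a b, Y.IdHom a b ⟶ A.IdHom (o a) (o b))
    (hc : ∀ a b c, Y.idComp a b c ≫ m a c = (m a b ⊗ₘ m b c) ≫ A.idComp (o a) (o b) (o c))
    (hm : ∀ a b, m a b ≫ idIndicator E A (o a) (o b) = idIndicator E Y a b) :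
    ∃ (m' : ∀ a b, Y.Path a b ⟶ A.Path (o a) (o b)),
      (∀ a b c, Y.comp a b c ≫ m' a c = (m' a b ⊗ₘ m' b c) ≫ A.comp (o a) (o b) (o c)) ∧
      ∀ a b, m' a b ≫ A.pathι (o a) (o b) = Y.pathι a b ≫ m a b := by
  have : ∀ a b, ∃ g : Y.Path a b ⟶ A.Path (o a) (o b),
      g ≫ A.pathι (o a) (o b) = Y.pathι a b ≫ m a b := fun a b =>
    exists_comp_pathι E hV _ <| by rw [Category.assoc, hm, pathι_idIndicator]
  choose m' hm' using this
  refine ⟨m', fun a b c => pathι_cancel hV ?_, hm'⟩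
  rw [Category.assoc, hm', Y.comp_pathι_comp (hc a b c), ← hm', ← hm',
    ← tensorHom_comp_tensorHom, Category.assoc, pathι_tensor_idComp, Category.assoc]

theorem addId_map_congr {X A : EnrSemicat.{w} V} {o : X.Obj → A.Obj}
    {m m' : ∀ a b, X.IdHom a b ⟶ A.IdHom (o a) (o b)} {i i' c c'}
    (h : (⟨o, m, i, c⟩ : EnrichedFunctor V X.addIdObj.Obj A.addIdObj.Obj) = ⟨o, m', i', c'⟩)
    (a b : X.Obj) : m a b = m' a b := by
  cases h
  rfl

/-- Compatibility of `m` with the indicators is automatic: following `m` by `idMap q` preserves the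
indicator and gives a map induced by a map of flows, which preserves it as well. -/
theorem exists_lift_of_idHom (E : TwoPointObject V) (hV : PointlessIsInitial V)
    {X Y A B : EnrSemicat.{w} V} (f : X ⟶ Y) (q : A ⟶ B)
    {o : Y.Obj → A.Obj} {um : ∀ a b, X.Path a b ⟶ A.Path (o (f.obj a)) (o (f.obj b))} {uc}
    {vm : ∀ a b, Y.Path a b ⟶ B.Path (q.obj (o a)) (q.obj (o b))} {vc}
    (m : ∀ a b, Y.IdHom a b ⟶ A.IdHom (o a) (o b))
    (hc : ∀ a b c, Y.idComp a b c ≫ m a c = (m a b ⊗ₘ m b c) ≫ A.idComp (o a) (o b) (o c))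
    (h₁ : ∀ a b, idMap f a b ≫ m (f.obj a) (f.obj b) =
      idMap (⟨fun x => o (f.obj x), um, uc⟩ : EnrSemifunctor X A) a b)
    (h₂ : ∀ a b, m a b ≫ idMap q (o a) (o b) =
      idMap (⟨fun y => q.obj (o y), vm, vc⟩ : EnrSemifunctor Y B) a b) :
    ∃ l : Y ⟶ A, f ≫ l = (⟨fun x => o (f.obj x), um, uc⟩ : EnrSemifunctor X A) ∧
      l ≫ q = (⟨fun y => q.obj (o y), vm, vc⟩ : EnrSemifunctor Y B) := by
  obtain ⟨m', mc, hm⟩ := exists_semifunctor_of_idIndicator E hV m hc fun a b => by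
    rw [← idMap_idIndicator E q, ← Category.assoc, h₂]
    exact idMap_idIndicator E _ a b
  refine ⟨(⟨o, m', mc⟩ : EnrSemifunctor Y A), hom_ext' fun a b => pathι_cancel hV ?_,
    hom_ext' fun a b => pathι_cancel hV ?_⟩
  · have := congrArg (X.pathι a b ≫ ·) (h₁ a b)
    simp only [pathι_idMap, ← Category.assoc] at this
    rw [Category.assoc, ← hm, ← Category.assoc] at this
    exact this
  · have := congrArg (Y.pathι a b ≫ ·) (h₂ a b)
    simp only [pathι_idMap, ← Category.assoc] at this
    rw [← hm, Category.assoc, pathι_idMap, ← Category.assoc] at this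
    exact this

/-- A map of flows has the left lifting property with respect to another one if this holds after
adding identities. -/
theorem hasLiftingProperty_of_addId (E : TwoPointObject V) (hV : PointlessIsInitial V)
    {X Y A B : EnrSemicat.{w} V} (f : X ⟶ Y) (q : A ⟶ B)
    (H : HasLiftingProperty ((addId V).map f) ((addId V).map q)) : HasLiftingProperty f q := by
  constructor
  rintro ⟨uo, um, uc⟩ ⟨vo, vm, vc⟩ ⟨sq⟩
  have sqI := congrArg (addId V).map sq
  rw [Functor.map_comp, Functor.map_comp] at sqI
  obtain ⟨⟨⟨lo, lm, li, lc⟩, hl, hl'⟩⟩ := H.sq_hasLift ⟨sqI⟩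
  -- Adding identities does not change the states, so the lift `lo` already solves the problem on
  -- states.
  obtain rfl : (fun x => lo (f.obj x)) = uo := congrArg EnrichedFunctor.obj hl
  obtain rfl : (fun y => q.obj (lo y)) = vo := congrArg EnrichedFunctor.obj hl'
  obtain ⟨l, hl₁, hl₂⟩ := exists_lift_of_idHom E hV f q (o := lo) lm lc
    (fun a b => addId_map_congr hl a b) (fun a b => addId_map_congr hl' a b)
  exact ⟨⟨⟨l, hl₁, hl₂⟩⟩⟩

end EnrSemicat

/-- The enriched category with set of objects `S` all of whose spaces of maps are points. -/
def EnrCat.codiscrete (V : Type u) [Category.{v} V] [CartesianMonoidalCategory V] (S : Type w) :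
    EnrCat.{w} V where
  Obj := S
  str :=
    { Hom := fun _ _ => 𝟙_ V
      id := fun _ => 𝟙 _
      comp := fun _ _ _ => toUnit _
      id_comp := fun _ _ => toUnit_unique _ _
      comp_id := fun _ _ => toUnit_unique _ _
      assoc := fun _ _ _ _ => toUnit_unique _ _ }

/-- The map of codiscrete enriched categories induced by a map of sets. -/
def EnrCat.codiscreteMap (V : Type u) [Category.{v} V] [CartesianMonoidalCategory V]
    {S T : Type w} (f : S → T) : codiscrete V S ⟶ codiscrete V T where
  obj := f
  map _ _ := 𝟙 (𝟙_ V)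
  map_id _ := toUnit_unique _ _
  map_comp _ _ _ := toUnit_unique _ _

/-- An enriched functor to a codiscrete enriched category. -/
def EnrCat.toCodiscrete {V : Type u} [Category.{v} V] [CartesianMonoidalCategory V]
    {C : EnrCat.{w} V} {S : Type w} (f : C.Obj → S) : C ⟶ codiscrete V S where
  obj := f
  map _ _ := toUnit _
  map_id _ := toUnit_unique _ _
  map_comp _ _ _ := toUnit_unique _ _

theorem EnrCat.hom_codiscrete_ext {V : Type u} [Category.{v} V] [CartesianMonoidalCategory V]
    {C : EnrCat.{w} V} {S : Type w} {F G : C ⟶ codiscrete V S} (h : F.obj = G.obj) : F = G := by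
  obtain ⟨Fo, Fm, _, _⟩ := F
  obtain ⟨Go, Gm, _, _⟩ := G
  obtain rfl : Fo = Go := h
  exact enrichedFunctor_ext rfl <| heq_of_eq <| funext fun a => funext fun b => toUnit_unique _ _

end

section Generators

variable (P : ObjectProperty TopCat.{u}) [CartesianMonoidalCategory P.FullSubcategory]
  [MonoidalClosed P.FullSubcategory] [IsLocallyPresentable.{u} P.FullSubcategory]
  (hS : ∀ n, P (TopCat.diskBoundary n)) (hD : ∀ n, P (TopCat.disk n))

/-- Functors to a codiscrete category are functions on objects, so lifting against the map from the
codiscrete category on `Prop` to the one on a point extends any predicate along `f`. Extending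
"equal to `x`" separates `x` from every other state. -/
theorem injective_of_iliasCof {X Y : EnrSemicat.{u} P.FullSubcategory} (f : X ⟶ Y)
    (hf : iliasCof P hS hD ((addId P.FullSubcategory).map f)) : Function.Injective f.obj := by
  let q := EnrCat.codiscreteMap P.FullSubcategory (fun _ : ULift.{u} Prop => PUnit.unit.{u + 1})
  have hq : ((IglC P hS hD).strictMap (addId P.FullSubcategory)).rlp q := by
    rw [rlp_strictMap_addId_iff, rlp_IglC_iff]
    refine ⟨fun _ => ⟨⟨True⟩, rfl⟩, fun n a b => ?_⟩
    -- On spaces of maps `q` is the identity of the terminal object.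
    exact inferInstanceAs (HasLiftingProperty (sphereIncl P hS hD n) (𝟙 (𝟙_ P.FullSubcategory)))
  intro x y hxy
  have sq : CommSq (EnrCat.toCodiscrete (C := (addId P.FullSubcategory).obj X)
        (fun z => (⟨z = x⟩ : ULift.{u} Prop)))
      ((addId P.FullSubcategory).map f) q
      (EnrCat.toCodiscrete fun _ => PUnit.unit) := ⟨EnrCat.hom_codiscrete_ext rfl⟩
  obtain ⟨⟨l, hl, -⟩⟩ := (hf q hq).sq_hasLift sq
  have h : ∀ z : X.Obj, l.obj (f.obj z) = ⟨z = x⟩ := fun z =>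
    congrFun (congrArg EnrichedFunctor.obj hl) z
  have := congrArg ULift.down ((h x).symm.trans ((congrArg l.obj hxy).trans (h y)))
  exact ((cast this rfl : y = x)).symm

end Generators

end

/-! ### Disks, the zero-sphere, and the equality of the left classes -/

noncomputable section

section Spaces

open TopCat

/-- The point of the boundary of the `1`-disk with coordinate `c`. -/
def diskBoundaryOnePoint (c : ℝ) (hc : |c| = 1) : (∂𝔻 1 : TopCat.{u}) :=
  ULift.up ⟨!₂[c], by simp [EuclideanSpace.norm_eq, Real.sqrt_sq_eq_abs, hc]⟩

theorem diskBoundary_one_eq (x : (∂𝔻 1 : TopCat.{u})) :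
    x = diskBoundaryOnePoint 1 (by simp) ∨ x = diskBoundaryOnePoint (-1) (by simp) := by
  obtain ⟨⟨x, hx⟩⟩ := x
  have hx' : |x 0| = 1 := by
    have : ‖x‖ = 1 := by simpa using hx
    simpa [EuclideanSpace.norm_eq, Real.sqrt_sq_eq_abs] using this
  have key : ∀ c : ℝ, x 0 = c → x = !₂[c] := by
    rintro c rfl
    ext i
    fin_cases i
    rfl
  rcases eq_or_eq_neg_of_abs_eq hx' with h | h
  · exact Or.inl (congrArg ULift.up (Subtype.ext (key _ h)))
  · exact Or.inr (congrArg ULift.up (Subtype.ext (key _ h)))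

theorem diskBoundaryOnePoint_ne :
    (diskBoundaryOnePoint 1 (by simp) : (∂𝔻 1 : TopCat.{u})) ≠
      diskBoundaryOnePoint (-1) (by simp) := by
  intro h
  have h' : (!₂[(1 : ℝ)] : EuclideanSpace ℝ (Fin 1)) = !₂[-1] :=
    congrArg Subtype.val (congrArg ULift.down h)
  have := congrArg (fun v : EuclideanSpace ℝ (Fin 1) => v 0) h'
  norm_num at this

theorem diskBoundary_one_discreteTopology : DiscreteTopology (∂𝔻 1 : TopCat.{u}) := by
  have : Finite (∂𝔻 1 : TopCat.{u}) := Finite.of_finite_univ <|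
    (Set.toFinite {diskBoundaryOnePoint 1 (by simp), diskBoundaryOnePoint (-1) (by simp)}).subset
      fun x _ => diskBoundary_one_eq x
  have : T1Space (∂𝔻 1 : TopCat.{u}) :=
    inferInstanceAs (T1Space (ULift (Metric.sphere (0 : EuclideanSpace ℝ (Fin 1)) 1)))
  infer_instance

theorem disk_preconnectedSpace (n : ℕ) : PreconnectedSpace (𝔻 n : TopCat.{u}) := by
  have : PreconnectedSpace (Metric.closedBall (0 : EuclideanSpace ℝ (Fin n)) 1) :=
    Subtype.preconnectedSpace (convex_closedBall _ _).isPreconnected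
  let e : ULift.{u} (Metric.closedBall (0 : EuclideanSpace ℝ (Fin n)) 1) ≃ₜ _ := Homeomorph.ulift
  exact e.symm.surjective.denseRange.preconnectedSpace e.symm.continuous

instance disk_nonempty (n : ℕ) : Nonempty (𝔻 n : TopCat.{u}) := ⟨ULift.up ⟨0, by simp⟩⟩

end Spaces

section Generators

variable (P : ObjectProperty TopCat.{u}) [CartesianMonoidalCategory P.FullSubcategory]

/-- The constant map. -/
def constHom (T : P.FullSubcategory) {K : P.FullSubcategory} (k : K.obj) : T ⟶ K :=
  ObjectProperty.homMk (TopCat.ofHom (ContinuousMap.const _ k))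

variable {P} in
theorem fullSubcategory_hom_ext {T K : P.FullSubcategory} {f g : T ⟶ K}
    (h : ∀ x : T.obj, f.hom x = g.hom x) : f = g := by
  apply ObjectProperty.hom_ext
  ext x
  exact h x

/-- The unit is only known to be terminal in the subcategory; constant maps, which exist by
fullness, detect that it has at most one point. -/
theorem unit_subsingleton : Subsingleton (𝟙_ P.FullSubcategory).obj := by
  refine ⟨fun x y => ?_⟩
  have := toUnit_unique (constHom P (𝟙_ P.FullSubcategory) x) (constHom P (𝟙_ P.FullSubcategory) y)
  exact congrArg (fun f : 𝟙_ P.FullSubcategory ⟶ 𝟙_ P.FullSubcategory => f.hom x) this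

theorem pointlessIsInitial : PointlessIsInitial P.FullSubcategory := by
  intro K
  rcases isEmpty_or_nonempty K.obj with hK | ⟨⟨k⟩⟩
  · refine Or.inr ⟨IsInitial.ofUniqueHom (fun L => ObjectProperty.homMk (TopCat.ofHom
      ⟨fun x => hK.elim x, continuous_of_discreteTopology⟩)) fun L m => ?_⟩
    exact fullSubcategory_hom_ext fun x => hK.elim x
  · exact Or.inl ⟨constHom P _ k⟩

theorem unit_nonempty (hD : ∀ n, P (TopCat.disk n)) : Nonempty (𝟙_ P.FullSubcategory).obj :=
  ⟨(toUnit (⟨_, hD 0⟩ : P.FullSubcategory)).hom (Classical.arbitrary _)⟩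

variable (hS : ∀ n, P (TopCat.diskBoundary n)) (hD : ∀ n, P (TopCat.disk n))

open Classical in
/-- The `0`-sphere as a two-point object. -/
def sphereTwoPointObject : TwoPointObject P.FullSubcategory where
  -- The boundary of the disk of dimension `1` is the sphere of dimension `0`.
  pt := ⟨_, hS 1⟩
  e₀ := constHom P (K := ⟨_, hS 1⟩) _ (diskBoundaryOnePoint 1 (by simp))
  e₁ := constHom P (K := ⟨_, hS 1⟩) _ (diskBoundaryOnePoint (-1) (by simp))
  ne h := by
    obtain ⟨x⟩ := unit_nonempty P hD
    have h' := congrArg (fun f : 𝟙_ P.FullSubcategory ⟶ ⟨_, hS 1⟩ => f.hom x) h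
    exact diskBoundaryOnePoint_ne h'
  exists_desc {Q} q₀ q₁ := by
    obtain ⟨x⟩ := unit_nonempty P hD
    have := unit_subsingleton P
    refine ⟨ObjectProperty.homMk (TopCat.ofHom
      ⟨fun e => if e = diskBoundaryOnePoint 1 (by simp) then q₀.hom x else q₁.hom x,
        @continuous_of_discreteTopology _ _ diskBoundary_one_discreteTopology _ _ _⟩), ?_, ?_⟩
    · refine fullSubcategory_hom_ext fun y => ?_
      rw [Subsingleton.elim y x]
      exact if_pos rfl
    · refine fullSubcategory_hom_ext fun y => ?_
      rw [Subsingleton.elim y x]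
      exact if_neg diskBoundaryOnePoint_ne.symm

/-- A continuous map from a connected space to a discrete one is constant. -/
theorem disk_to_sphere (n : ℕ)
    (c : (⟨_, hD n⟩ : P.FullSubcategory) ⟶ (sphereTwoPointObject P hS hD).pt) :
    c = toUnit _ ≫ (sphereTwoPointObject P hS hD).e₀ ∨
      c = toUnit _ ≫ (sphereTwoPointObject P hS hD).e₁ := by
  have key : ∀ x y : TopCat.disk n, c.hom x = c.hom y := fun x y =>
    @PreconnectedSpace.constant _ _ _ _ diskBoundary_one_discreteTopology
      (disk_preconnectedSpace n) _ c.hom.hom.continuous x y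
  obtain ⟨x₀⟩ : Nonempty (TopCat.disk n) := inferInstance
  rcases diskBoundary_one_eq (c.hom x₀) with h | h
  · exact Or.inl (fullSubcategory_hom_ext fun x => (key x x₀).trans h)
  · exact Or.inr (fullSubcategory_hom_ext fun x => (key x x₀).trans h)

variable [MonoidalClosed P.FullSubcategory] [IsLocallyPresentable.{u} P.FullSubcategory]

theorem rlp_strictMap_addId_map {A B : EnrSemicat.{u} P.FullSubcategory} (q : A ⟶ B)
    (hq : (IglC P hS hD).rlp q) (hq' : Function.Injective q.obj) :
    ((IglC P hS hD).strictMap (addId P.FullSubcategory)).rlp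
      ((addId P.FullSubcategory).map q) := by
  rw [rlp_IglC_iff] at hq
  rw [rlp_strictMap_addId_iff, rlp_IglC_iff]
  exact ⟨hq.1, fun n a b => EnrSemicat.idMap_hasLiftingProperty (sphereTwoPointObject P hS hD)
    (pointlessIsInitial P) _ (constHom P (K := ⟨_, hD n⟩) _ (Classical.arbitrary (TopCat.disk n)))
    (disk_to_sphere P hS hD n) q hq' a b (hq.2 n a b)⟩

theorem inverseImage_iliasCof :
    (iliasCof P hS hD).inverseImage (addId P.FullSubcategory) = (IglC P hS hD).rlp.llp := by
  refine le_antisymm ?_ (llp_rlp_le_inverseImage_addId _)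
  intro X Y f hf A B p hp
  have hp' := (rlp_IglC_iff P hS hD p).1 hp
  refine EnrSemicat.hasLiftingProperty_of_obj f (injective_of_iliasCof P hS hD f hf) p hp'.1 ?_
  intro h um uc vm vc sq
  -- The pulled-back map is the identity on states, which is what makes its image under `addId` a
  -- trivial fibration.
  have hq : (IglC P hS hD).rlp (EnrSemicat.pullMap p h) :=
    (rlp_IglC_iff P hS hD _).2 ⟨Function.surjective_id, fun n a b => hp'.2 n (h a) (h b)⟩
  have hfq : HasLiftingProperty f (EnrSemicat.pullMap p h) :=
    EnrSemicat.hasLiftingProperty_of_addId (sphereTwoPointObject P hS hD) (pointlessIsInitial P)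
      _ _ (hf _ (rlp_strictMap_addId_map P hS hD _ hq Function.injective_id))
  let u : X ⟶ A.pull h := ⟨f.obj, um, uc⟩
  let v : Y ⟶ B.pull fun y => p.obj (h y) := ⟨fun y => y, vm, vc⟩
  have hsq : CommSq u f (EnrSemicat.pullMap p h) v :=
    ⟨EnrSemicat.hom_ext' (X := X) (Y := B.pull fun y => p.obj (h y)) (o := f.obj) sq⟩
  -- The square factors through the pulled-back map, so a lift there composes to a lift against `p`.
  refine ⟨hsq.lift ≫ A.pullι h, ?_, ?_⟩
  · rw [hsq.fac_left_assoc]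
    exact EnrSemicat.hom_ext' (X := X) (Y := A) (o := fun a => h (f.obj a))
      fun a b => Category.comp_id (um a b)
  · have : (A.pullι h) ≫ p = EnrSemicat.pullMap p h ≫ B.pullι _ :=
      EnrSemicat.hom_ext' (X := A.pull h) (Y := B) (o := fun y => p.obj (h y)) fun a b =>
        (Category.id_comp (p.map (h a) (h b))).trans (Category.comp_id (p.map (h a) (h b))).symm
    rw [Category.assoc, this, hsq.fac_right_assoc]
    exact EnrSemicat.hom_ext' (X := Y) (Y := B) (o := fun a => p.obj (h a))
      fun a b => Category.comp_id (vm a b)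

end Generators

end

/-! ### Presentability, and lifting conditions for diagrams -/

noncomputable section

section SmallObject

open MorphismProperty

theorem isSmall_sup {C : Type u} [Category.{v} C] (W₁ W₂ : MorphismProperty C) [IsSmall.{w} W₁]
    [IsSmall.{w} W₂] : IsSmall.{w} (W₁ ⊔ W₂) where
  small_toSet := by
    let φ : W₁.toSet ⊕ W₂.toSet → (W₁ ⊔ W₂).toSet :=
      Sum.elim (fun f => ⟨f.1, Or.inl f.2⟩) (fun f => ⟨f.1, Or.inr f.2⟩)
    refine small_of_surjective (f := φ) ?_
    rintro ⟨f, hf | hf⟩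
    · exact ⟨Sum.inl ⟨f, hf⟩, rfl⟩
    · exact ⟨Sum.inr ⟨f, hf⟩, rfl⟩

theorem exists_regular_cardinal_le {ι : Type v} [Small.{w} ι] (κ : ι → Cardinal.{w}) :
    ∃ (κ' : Cardinal.{w}) (_ : Fact κ'.IsRegular), ∀ i, κ i ≤ κ' := by
  obtain ⟨κ', h₁, h₂⟩ := HasCardinalLT.exists_regular_cardinal_forall.{w}
    (fun i => (κ i).ord.ToType)
  exact ⟨κ', ⟨h₁⟩, fun i => le_of_lt (by simpa [hasCardinalLT_iff_cardinal_mk_lt] using h₂ i)⟩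

/-- One regular cardinal bounds the size of the shape and the presentability ranks of all the
objects at once. -/
theorem isPresentable_of_isColimit {C : Type u} [Category.{v} C] [LocallySmall.{w} C]
    {K : Type*} [Category* K] [Small.{w} K] [Small.{w} (Arrow K)] [HasLimitsOfShape Kᵒᵖ (Type w)]
    {Y : K ⥤ C} (c : Cocone Y) (hc : IsColimit c) (h : ∀ k, IsPresentable.{w} (Y.obj k)) :
    IsPresentable.{w} c.pt := by
  choose κ _ hκ using fun k => (h k).exists_cardinal
  obtain ⟨κ₀, h₁, h₂⟩ := HasCardinalLT.exists_regular_cardinal.{w} (Arrow K)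
  obtain ⟨κ', _, hκ'⟩ := exists_regular_cardinal_le (Sum.elim (fun _ : Unit => κ₀) κ)
  have : ∀ k, IsCardinalPresentable (Y.obj k) κ' := fun k =>
    have : IsCardinalPresentable (Y.obj k) (κ k) := hκ k
    isCardinalPresentable_of_le (κ := κ k) _ (hκ' (Sum.inr k))
  have := isCardinalPresentable_of_isColimit c hc κ' (h₂.of_le (hκ' (Sum.inl ())))
  exact isPresentable_of_isCardinalPresentable _ κ'

/-- A common regular cardinal makes all the sources presentable of the same rank, hence small for
transfinite compositions of that length. -/
theorem hasSmallObjectArgument_of_isPresentable {C : Type u} [Category.{v} C]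
    [LocallySmall.{w} C] [HasColimitsOfSize.{w, w} C] (I : MorphismProperty C) [IsSmall.{w} I]
    (hI : ∀ {A B : C} (i : A ⟶ B), I i → IsPresentable.{w} A) :
    HasSmallObjectArgument.{w} I := by
  have := fun i : I.toSet => (hI i.1.hom i.2).exists_cardinal
  choose κ _ hκ using this
  obtain ⟨κ', _, hκ'⟩ := exists_regular_cardinal_le κ
  have hreg : κ'.IsRegular := Fact.out
  have : Nonempty κ'.ord.ToType := by simpa using hreg.ne_zero
  have := WellFoundedLT.toOrderBot κ'.ord.ToType
  have := hasColimitsOfSizeShrink.{0, 0, w, w} C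
  exact ⟨κ', inferInstance, inferInstance,
    { preservesColimit := fun {A B X Y} i hi f hf => by
        have : IsCardinalPresentable A (κ ⟨Arrow.mk i, hi⟩) := hκ ⟨Arrow.mk i, hi⟩
        have : IsCardinalPresentable A κ' := isCardinalPresentable_of_le _ (hκ' ⟨Arrow.mk i, hi⟩)
        have := preservesColimitsOfShape_of_isCardinalPresentable A κ' κ'.ord.ToType
        infer_instance }⟩

end SmallObject

section Diagrams

variable {J : Type v} [SmallCategory J] {V : Type u} [Category.{v} V] [HasColimitsOfSize.{v, v} V]

/-- Maps out of a free diagram. -/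
def freeHomEquiv {j : J} {T : V} {G : J ⥤ V} :
    ((evaluationLeftAdjoint V j).obj T ⟶ G) ≃ (T ⟶ G.obj j) :=
  (evaluationAdjunctionRight V j).homEquiv T G

theorem freeHomEquiv_comp {j : J} {T : V} {G H : J ⥤ V}
    (f : (evaluationLeftAdjoint V j).obj T ⟶ G) (p : G ⟶ H) :
    freeHomEquiv (f ≫ p) = freeHomEquiv f ≫ p.app j :=
  (evaluationAdjunctionRight V j).homEquiv_naturality_right f p

/-- The map of free diagrams induced by a morphism of indices. -/
def freeMap {j k : J} (φ : j ⟶ k) (T : V) :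
    (evaluationLeftAdjoint V k).obj T ⟶ (evaluationLeftAdjoint V j).obj T :=
  freeHomEquiv.symm (freeHomEquiv (𝟙 _) ≫ ((evaluationLeftAdjoint V j).obj T).map φ)

theorem freeHomEquiv_freeMap_comp {j k : J} (φ : j ⟶ k) {T : V} {G : J ⥤ V}
    (f : (evaluationLeftAdjoint V j).obj T ⟶ G) :
    freeHomEquiv (freeMap φ T ≫ f) = freeHomEquiv f ≫ G.map φ := by
  rw [freeHomEquiv_comp, freeMap, Equiv.apply_symm_apply, Category.assoc, f.naturality,
    ← Category.assoc, ← freeHomEquiv_comp, Category.id_comp]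

theorem isPresentable_free [IsLocallyPresentable.{v} V] (j : J) (T : V) :
    IsPresentable.{v} ((evaluationLeftAdjoint V j).obj T) := by
  obtain ⟨κ, _, _⟩ := (inferInstance : IsPresentable.{v} T).exists_cardinal
  have : IsCardinalPresentable T κ := ‹_›
  have := (evaluationAdjunctionRight V j).isCardinalPresentable_leftAdjoint_obj κ T
  exact isPresentable_of_isCardinalPresentable _ κ

variable {ι : Type v} {j : J} {k : ι → J} (φ : ∀ i, j ⟶ k i) (T : V)

/-- The map corepresenting the comparison of `G.obj j` with the product of the `G.obj (k i)`. -/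
def coneMap : ∐ (fun i => (evaluationLeftAdjoint V (k i)).obj T) ⟶
    (evaluationLeftAdjoint V j).obj T :=
  Sigma.desc fun i => freeMap (φ i) T

/-- The relative codiagonal of a map. -/
def relCodiag {C : Type*} [Category* C] [HasPushouts C] {A B : C} (s : A ⟶ B) : pushout s s ⟶ B :=
  pushout.desc (𝟙 _) (𝟙 _) rfl

/-- Free diagrams corepresent evaluation on `T`-elements, so a square is an element of `H.obj j`
whose faces are lifted to `G`, and a lift is a filler. With
`hasLiftingProperty_relCodiag_coneMap_iff` this expresses existence and uniqueness of fillers as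
lifting properties. -/
theorem hasLiftingProperty_coneMap_iff {G H : J ⥤ V} (p : G ⟶ H) :
    HasLiftingProperty (coneMap φ T) p ↔
      ∀ (x : T ⟶ H.obj j) (y : ∀ i, T ⟶ G.obj (k i)),
        (∀ i, y i ≫ p.app (k i) = x ≫ H.map (φ i)) →
        ∃ z : T ⟶ G.obj j, z ≫ p.app j = x ∧ ∀ i, z ≫ G.map (φ i) = y i := by
  constructor
  · intro hp x y h
    have sq : CommSq (Sigma.desc fun i => freeHomEquiv.symm (y i)) (coneMap φ T) p
        (freeHomEquiv.symm x) := by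
      refine ⟨Sigma.hom_ext _ _ fun i => ?_⟩
      simp only [coneMap, Sigma.ι_desc_assoc]
      apply freeHomEquiv.injective
      rw [freeHomEquiv_comp, freeHomEquiv_freeMap_comp, Equiv.apply_symm_apply,
        Equiv.apply_symm_apply, h]
    refine ⟨freeHomEquiv sq.lift, ?_, fun i => ?_⟩
    · rw [← freeHomEquiv_comp, sq.fac_right, Equiv.apply_symm_apply]
    · have := Sigma.ι (fun i => (evaluationLeftAdjoint V (k i)).obj T) i ≫= sq.fac_left
      simp only [coneMap, Sigma.ι_desc_assoc, Sigma.ι_desc] at this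
      rw [← freeHomEquiv_freeMap_comp]
      exact (congrArg freeHomEquiv this).trans (Equiv.apply_symm_apply _ _)
  · intro hp
    constructor
    intro u v ⟨sq⟩
    obtain ⟨z, hz, hz'⟩ := hp (freeHomEquiv v)
      (fun i => freeHomEquiv (Sigma.ι (fun i => (evaluationLeftAdjoint V (k i)).obj T) i ≫ u))
      (fun i => by
        rw [← freeHomEquiv_freeMap_comp, ← freeHomEquiv_comp, Category.assoc, sq]
        simp only [coneMap, Sigma.ι_desc_assoc])
    refine ⟨⟨⟨freeHomEquiv.symm z, Sigma.hom_ext _ _ fun i => ?_, ?_⟩⟩⟩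
    · simp only [coneMap, Sigma.ι_desc_assoc]
      apply freeHomEquiv.injective
      rw [freeHomEquiv_freeMap_comp, Equiv.apply_symm_apply, hz']
    · apply freeHomEquiv.injective
      rw [freeHomEquiv_comp, Equiv.apply_symm_apply, hz]

/-- A map out of the pushout is a pair of maps agreeing on `A`; it extends over the codiagonal
exactly when the two are equal. -/
theorem hasLiftingProperty_relCodiag_iff {C : Type*} [Category* C] [HasPushouts C] {A B : C}
    (s : A ⟶ B) {X Y : C} (p : X ⟶ Y) : HasLiftingProperty (relCodiag s) p ↔
      ∀ z z' : B ⟶ X, z ≫ p = z' ≫ p → s ≫ z = s ≫ z' → z = z' := by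
  constructor
  · intro hp z z' h₁ h₂
    have sq : CommSq (pushout.desc z z' h₂) (relCodiag s) p (z ≫ p) :=
      ⟨pushout.hom_ext
        (by simp only [relCodiag, pushout.inl_desc_assoc, Category.id_comp])
        (by simp only [relCodiag, pushout.inr_desc_assoc, Category.id_comp, h₁])⟩
    have h₃ := pushout.inl s s ≫= sq.fac_left
    have h₄ := pushout.inr s s ≫= sq.fac_left
    simp only [relCodiag, pushout.inl_desc_assoc, pushout.inl_desc, pushout.inr_desc_assoc,
      pushout.inr_desc, Category.id_comp] at h₃ h₄
    exact h₃.symm.trans h₄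
  · intro hp
    constructor
    intro u v ⟨sq⟩
    have h₁ := pushout.inl s s ≫= sq
    have h₂ := pushout.inr s s ≫= sq
    simp only [relCodiag, pushout.inl_desc_assoc, pushout.inr_desc_assoc, Category.id_comp] at h₁ h₂
    have h := hp (pushout.inl s s ≫ u) (pushout.inr s s ≫ u)
      (by rw [Category.assoc, Category.assoc, h₁, h₂]) (by rw [pushout.condition_assoc])
    exact ⟨⟨⟨pushout.inl s s ≫ u, pushout.hom_ext
      (by simp only [relCodiag, pushout.inl_desc_assoc, Category.id_comp])
      (by simp only [relCodiag, pushout.inr_desc_assoc, Category.id_comp, h]),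
      by rw [Category.assoc, h₁]⟩⟩⟩

theorem hasLiftingProperty_relCodiag_coneMap_iff {G H : J ⥤ V} (p : G ⟶ H) :
    HasLiftingProperty (relCodiag (coneMap φ T)) p ↔
      ∀ z z' : T ⟶ G.obj j, z ≫ p.app j = z' ≫ p.app j →
        (∀ i, z ≫ G.map (φ i) = z' ≫ G.map (φ i)) → z = z' := by
  rw [hasLiftingProperty_relCodiag_iff]
  have key : ∀ f f' : (evaluationLeftAdjoint V j).obj T ⟶ G,
      coneMap φ T ≫ f = coneMap φ T ≫ f' ↔
        ∀ i, freeHomEquiv f ≫ G.map (φ i) = freeHomEquiv f' ≫ G.map (φ i) := by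
    intro f f'
    simp only [← freeHomEquiv_freeMap_comp, EmbeddingLike.apply_eq_iff_eq]
    constructor
    · intro h i
      have := Sigma.ι (fun i => (evaluationLeftAdjoint V (k i)).obj T) i ≫= h
      simpa only [coneMap, Sigma.ι_desc_assoc] using this
    · intro h
      refine Sigma.hom_ext _ _ fun i => ?_
      simpa only [coneMap, Sigma.ι_desc_assoc] using h i
  constructor
  · intro h z z' h₁ h₂
    apply freeHomEquiv.symm.injective
    refine h _ _ (freeHomEquiv.injective ?_) ((key _ _).2 ?_)
    · simpa [freeHomEquiv_comp] using h₁
    · simpa using h₂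
  · intro h z z' h₁ h₂
    apply freeHomEquiv.injective
    refine h _ _ ?_ ((key _ _).1 h₂)
    rw [← freeHomEquiv_comp, h₁, freeHomEquiv_comp]

theorem isPresentable_coneMap_source [IsLocallyPresentable.{v} V] :
    IsPresentable.{v} (∐ (fun i => (evaluationLeftAdjoint V (k i)).obj T)) :=
  isPresentable_of_isColimit _ (colimit.isColimit
    (Discrete.functor fun i => (evaluationLeftAdjoint V (k i)).obj T)) fun i =>
      isPresentable_free (k i.as) T

theorem isPresentable_pushout {C : Type u} [Category.{v} C] [HasPushouts C] {X Y Z : C} (f : X ⟶ Y)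
    (g : X ⟶ Z) (hX : IsPresentable.{v} X) (hY : IsPresentable.{v} Y) (hZ : IsPresentable.{v} Z) :
    IsPresentable.{v} (pushout f g) := by
  have : Small.{v} (Arrow WalkingSpan) := by
    infer_instance
  refine isPresentable_of_isColimit _ (colimit.isColimit (span f g)) fun k => ?_
  rcases k with _ | _ | _
  exacts [hX, hY, hZ]

end Diagrams

end

/-! ### Shapes of strings of paths, and the nerve of a flow -/

noncomputable section

/-- The shapes of strings of at most three composable execution paths between states in `S`. -/
inductive FlowShape (S : Type v) : Type v
  | edge (a b : S) : FlowShape S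
  | tri (a b c : S) : FlowShape S
  | tet (a b c d : S) : FlowShape S

namespace FlowShape

variable {S T : Type v}

/-- The faces of the shapes. -/
inductive Hom : FlowShape S → FlowShape S → Type v
  | id (x : FlowShape S) : Hom x x
  | e01 (a b c : S) : Hom (tri a b c) (edge a b)
  | e12 (a b c : S) : Hom (tri a b c) (edge b c)
  | e02 (a b c : S) : Hom (tri a b c) (edge a c)
  | f012 (a b c d : S) : Hom (tet a b c d) (tri a b c)
  | f123 (a b c d : S) : Hom (tet a b c d) (tri b c d)
  | f023 (a b c d : S) : Hom (tet a b c d) (tri a c d)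
  | f013 (a b c d : S) : Hom (tet a b c d) (tri a b d)
  | g01 (a b c d : S) : Hom (tet a b c d) (edge a b)
  | g12 (a b c d : S) : Hom (tet a b c d) (edge b c)
  | g23 (a b c d : S) : Hom (tet a b c d) (edge c d)
  | g02 (a b c d : S) : Hom (tet a b c d) (edge a c)
  | g13 (a b c d : S) : Hom (tet a b c d) (edge b d)
  | g03 (a b c d : S) : Hom (tet a b c d) (edge a d)

/-- The composition of faces. -/
def Hom.comp : ∀ {x y z : FlowShape S}, Hom x y → Hom y z → Hom x z
  | _, _, _, .id _, g => g
  | _, _, _, .e01 a b c, .id _ => .e01 a b c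
  | _, _, _, .e12 a b c, .id _ => .e12 a b c
  | _, _, _, .e02 a b c, .id _ => .e02 a b c
  | _, _, _, .f012 a b c d, .id _ => .f012 a b c d
  | _, _, _, .f012 a b c d, .e01 _ _ _ => .g01 a b c d
  | _, _, _, .f012 a b c d, .e12 _ _ _ => .g12 a b c d
  | _, _, _, .f012 a b c d, .e02 _ _ _ => .g02 a b c d
  | _, _, _, .f123 a b c d, .id _ => .f123 a b c d
  | _, _, _, .f123 a b c d, .e01 _ _ _ => .g12 a b c d
  | _, _, _, .f123 a b c d, .e12 _ _ _ => .g23 a b c d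
  | _, _, _, .f123 a b c d, .e02 _ _ _ => .g13 a b c d
  | _, _, _, .f023 a b c d, .id _ => .f023 a b c d
  | _, _, _, .f023 a b c d, .e01 _ _ _ => .g02 a b c d
  | _, _, _, .f023 a b c d, .e12 _ _ _ => .g23 a b c d
  | _, _, _, .f023 a b c d, .e02 _ _ _ => .g03 a b c d
  | _, _, _, .f013 a b c d, .id _ => .f013 a b c d
  | _, _, _, .f013 a b c d, .e01 _ _ _ => .g01 a b c d
  | _, _, _, .f013 a b c d, .e12 _ _ _ => .g13 a b c d
  | _, _, _, .f013 a b c d, .e02 _ _ _ => .g03 a b c d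
  | _, _, _, .g01 a b c d, .id _ => .g01 a b c d
  | _, _, _, .g12 a b c d, .id _ => .g12 a b c d
  | _, _, _, .g23 a b c d, .id _ => .g23 a b c d
  | _, _, _, .g02 a b c d, .id _ => .g02 a b c d
  | _, _, _, .g13 a b c d, .id _ => .g13 a b c d
  | _, _, _, .g03 a b c d, .id _ => .g03 a b c d

instance : SmallCategory (FlowShape S) where
  Hom := Hom
  id := Hom.id
  comp := Hom.comp
  id_comp f := by cases f <;> rfl
  comp_id f := by cases f <;> rfl
  assoc f g h := by cases f <;> cases g <;> cases h <;> rfl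

/-- The map on shapes induced by a map of sets of states. -/
def mapObj (f : S → T) : FlowShape S → FlowShape T
  | edge a b => edge (f a) (f b)
  | tri a b c => tri (f a) (f b) (f c)
  | tet a b c d => tet (f a) (f b) (f c) (f d)

/-- The map on faces induced by a map of sets of states. -/
def Hom.map (f : S → T) : ∀ {x y : FlowShape S}, Hom x y → Hom (x.mapObj f) (y.mapObj f)
  | _, _, .id x => .id (x.mapObj f)
  | _, _, .e01 a b c => .e01 (f a) (f b) (f c)
  | _, _, .e12 a b c => .e12 (f a) (f b) (f c)
  | _, _, .e02 a b c => .e02 (f a) (f b) (f c)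
  | _, _, .f012 a b c d => .f012 (f a) (f b) (f c) (f d)
  | _, _, .f123 a b c d => .f123 (f a) (f b) (f c) (f d)
  | _, _, .f023 a b c d => .f023 (f a) (f b) (f c) (f d)
  | _, _, .f013 a b c d => .f013 (f a) (f b) (f c) (f d)
  | _, _, .g01 a b c d => .g01 (f a) (f b) (f c) (f d)
  | _, _, .g12 a b c d => .g12 (f a) (f b) (f c) (f d)
  | _, _, .g23 a b c d => .g23 (f a) (f b) (f c) (f d)
  | _, _, .g02 a b c d => .g02 (f a) (f b) (f c) (f d)
  | _, _, .g13 a b c d => .g13 (f a) (f b) (f c) (f d)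
  | _, _, .g03 a b c d => .g03 (f a) (f b) (f c) (f d)

theorem Hom.map_comp (f : S → T) {x y z : FlowShape S} (g : Hom x y) (h : Hom y z) :
    (g.comp h).map f = (g.map f).comp (h.map f) := by
  cases g <;> cases h <;> rfl

/-- The functor induced by a map of sets of states. -/
def map (f : S → T) : FlowShape S ⥤ FlowShape T where
  obj := mapObj f
  map := Hom.map f
  map_id _ := rfl
  map_comp := Hom.map_comp f

end FlowShape

section Nerve

open FlowShape

variable {V : Type u} [Category.{v} V] [CartesianMonoidalCategory V] {S : Type v}

namespace EnrSemicat

/-- The object of strings of composable paths of a given shape. -/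
def nerveObj (A : EnrSemicat.{v} V) (h : S → A.Obj) : FlowShape S → V
  | edge a b => A.Path (h a) (h b)
  | tri a b c => A.Path (h a) (h b) ⊗ A.Path (h b) (h c)
  | tet a b c d => A.Path (h a) (h b) ⊗ (A.Path (h b) (h c) ⊗ A.Path (h c) (h d))

/-- The maps induced by the faces on strings of composable paths. -/
def nerveMap (A : EnrSemicat.{v} V) (h : S → A.Obj) : ∀ {x y : FlowShape S}, FlowShape.Hom x y →
    (A.nerveObj h x ⟶ A.nerveObj h y)
  | _, _, .id _ => 𝟙 _
  | _, _, .e01 a b c => fst (A.Path (h a) (h b)) (A.Path (h b) (h c))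
  | _, _, .e12 a b c => snd (A.Path (h a) (h b)) (A.Path (h b) (h c))
  | _, _, .e02 a b c => A.comp (h a) (h b) (h c)
  | _, _, .f012 a b c d => A.Path (h a) (h b) ◁ fst (A.Path (h b) (h c)) (A.Path (h c) (h d))
  | _, _, .f123 a b c d =>
    snd (A.Path (h a) (h b)) (A.Path (h b) (h c) ⊗ A.Path (h c) (h d))
  | _, _, .f023 a b c d => (α_ (A.Path (h a) (h b)) (A.Path (h b) (h c)) (A.Path (h c) (h d))).inv ≫
      A.comp (h a) (h b) (h c) ▷ A.Path (h c) (h d)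
  | _, _, .f013 a b c d => A.Path (h a) (h b) ◁ A.comp (h b) (h c) (h d)
  | _, _, .g01 a b c d =>
    fst (A.Path (h a) (h b)) (A.Path (h b) (h c) ⊗ A.Path (h c) (h d))
  | _, _, .g12 a b c d =>
    snd (A.Path (h a) (h b)) (A.Path (h b) (h c) ⊗ A.Path (h c) (h d)) ≫ fst _ _
  | _, _, .g23 a b c d =>
    snd (A.Path (h a) (h b)) (A.Path (h b) (h c) ⊗ A.Path (h c) (h d)) ≫ snd _ _
  | _, _, .g02 a b c d =>
    A.Path (h a) (h b) ◁ fst (A.Path (h b) (h c)) (A.Path (h c) (h d)) ≫ A.comp (h a) (h b) (h c)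
  | _, _, .g13 a b c d =>
    snd (A.Path (h a) (h b)) (A.Path (h b) (h c) ⊗ A.Path (h c) (h d)) ≫ A.comp (h b) (h c) (h d)
  | _, _, .g03 a b c d =>
    A.Path (h a) (h b) ◁ A.comp (h b) (h c) (h d) ≫ A.comp (h a) (h b) (h d)

theorem nerveMap_comp (A : EnrSemicat.{v} V) (h : S → A.Obj) {x y z : FlowShape S}
    (f : FlowShape.Hom x y) (g : FlowShape.Hom y z) :
    A.nerveMap h (f.comp g) = A.nerveMap h f ≫ A.nerveMap h g := by
  cases f <;> cases g
  all_goals first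
    | exact (Category.id_comp _).symm
    | exact (Category.comp_id _).symm
    | rfl
    | skip
  all_goals dsimp only [nerveMap, Hom.comp, nerveObj]
  all_goals try simp only [whiskerLeft_fst, whiskerLeft_snd, Category.assoc, whiskerRight_fst,
    whiskerRight_snd]
  · rw [← Category.assoc (α_ _ _ _).inv]
    congr 1
    ext <;> simp
  · simp
  -- The long edge of a tetrahedron, reached through `f023` or through `f013`: this is associativity
  -- in `A`.
  · rw [A.assoc, Iso.inv_hom_id_assoc]

/-- The diagram of strings of at most three composable paths. -/
def nerve (A : EnrSemicat.{v} V) (h : S → A.Obj) : FlowShape S ⥤ V where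
  obj := A.nerveObj h
  map f := A.nerveMap h f
  map_id _ := rfl
  map_comp f g := A.nerveMap_comp h f g

variable {A : EnrSemicat.{v} V} {h : S → A.Obj} {G : FlowShape S ⥤ V}

theorem _root_.FlowShape.map_map (G : FlowShape S ⥤ V) {x y z : FlowShape S} (f : Hom x y)
    (g : Hom y z) {W : V} (r : G.obj z ⟶ W) :
    G.map (X := x) (Y := y) f ≫ G.map (X := y) (Y := z) g ≫ r =
      G.map (X := x) (Y := z) (f.comp g) ≫ r :=
  (G.map_comp_assoc (X := x) (Y := y) (Z := z) f g r).symm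

/-- The components of a map to a nerve. -/
def toNerveApp (g : ∀ a b, G.obj (edge a b) ⟶ A.Path (h a) (h b)) :
    ∀ x, G.obj x ⟶ A.nerveObj h x
  | edge a b => g a b
  | tri a b c => lift (G.map (Y := edge a b) (.e01 a b c) ≫ g a b)
      (G.map (Y := edge b c) (.e12 a b c) ≫ g b c)
  | tet a b c d => lift (G.map (Y := edge a b) (.g01 a b c d) ≫ g a b)
      (lift (G.map (Y := edge b c) (.g12 a b c d) ≫ g b c)
        (G.map (Y := edge c d) (.g23 a b c d) ≫ g c d))

/-- The compatibility of a map with compositions. -/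
def IsMultiplicative (g : ∀ a b, G.obj (edge a b) ⟶ A.Path (h a) (h b)) : Prop :=
  ∀ a b c, G.map (Y := edge a c) (Hom.e02 a b c) ≫ g a c =
    lift (G.map (Y := edge a b) (.e01 a b c) ≫ g a b)
      (G.map (Y := edge b c) (.e12 a b c) ≫ g b c) ≫ A.comp (h a) (h b) (h c)

/-- Strings in a nerve are determined by their spine, so only faces that compose paths need an
argument. Those follow from multiplicativity restricted to the triangular faces of a tetrahedron. -/
theorem toNerveApp_naturality {g : ∀ a b, G.obj (edge a b) ⟶ A.Path (h a) (h b)}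
    (hg : IsMultiplicative g) {x y : FlowShape S} (f : Hom x y) :
    G.map (X := x) (Y := y) f ≫ toNerveApp g y = toNerveApp g x ≫ A.nerveMap h f := by
  have hg' : ∀ {a b c : S} {W : FlowShape S} (k : Hom W (tri a b c)),
      G.map (X := W) (Y := edge a c) (k.comp (Hom.e02 a b c)) ≫ g a c =
        lift (G.map (X := W) (Y := edge a b) (k.comp (.e01 a b c)) ≫ g a b)
          (G.map (X := W) (Y := edge b c) (k.comp (.e12 a b c)) ≫ g b c) ≫
            A.comp (h a) (h b) (h c) := by
    intro a b c W k
    rw [← FlowShape.map_map, hg, comp_lift_assoc, FlowShape.map_map, FlowShape.map_map]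
  cases f
  case id =>
    exact (congrArg (· ≫ _) (G.map_id x)).trans
      ((Category.id_comp _).trans (Category.comp_id _).symm)
  case e02 a b c => exact hg a b c
  case f023 a b c d =>
    have h02 := hg' (.f012 a b c d)
    dsimp only [toNerveApp, nerveMap, nerveObj]
    rw [comp_lift, FlowShape.map_map, FlowShape.map_map, lift_lift_associator_inv_assoc,
      lift_whiskerRight]
    exact congrArg (lift · _) h02
  case f013 a b c d =>
    have h13 := hg' (.f123 a b c d)
    dsimp only [toNerveApp, nerveMap, nerveObj]
    rw [comp_lift, FlowShape.map_map, FlowShape.map_map, lift_whiskerLeft]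
    exact congrArg (lift _ ·) h13
  case g02 a b c d =>
    dsimp only [toNerveApp, nerveMap, nerveObj]
    rw [lift_whiskerLeft_assoc, lift_fst]
    exact hg' (.f012 a b c d)
  case g13 a b c d =>
    dsimp only [toNerveApp, nerveMap, nerveObj]
    rw [lift_snd_assoc]
    exact hg' (.f123 a b c d)
  case g03 a b c d =>
    dsimp only [toNerveApp, nerveMap, nerveObj]
    rw [lift_whiskerLeft_assoc]
    exact (hg' (.f013 a b c d)).trans (congrArg
      (fun t => lift _ t ≫ A.comp (h a) (h b) (h d)) (hg' (.f123 a b c d)))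
  all_goals dsimp only [toNerveApp, nerveMap, nerveObj]
  all_goals simp only [comp_lift, FlowShape.map_map, lift_fst, lift_snd, lift_snd_assoc,
    lift_fst_assoc, lift_whiskerLeft, lift_whiskerRight]
  all_goals rfl

/-- A map to a nerve is given by multiplicative maps to the objects of paths. -/
def toNerve (g : ∀ a b, G.obj (edge a b) ⟶ A.Path (h a) (h b)) (hg : IsMultiplicative g) :
    G ⟶ A.nerve h where
  app := toNerveApp g
  naturality _ _ f := toNerveApp_naturality hg f

/-- The projections of a product of path objects are themselves faces, so naturality determines the
components at triangles and tetrahedra from those at edges. -/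
theorem nerve_hom_ext {α β : G ⟶ A.nerve h}
    (H : ∀ a b, (α.app (edge a b) : G.obj (edge a b) ⟶ A.Path (h a) (h b)) =
      β.app (edge a b)) : α = β := by
  have nat : ∀ (γ : G ⟶ A.nerve h) {x y : FlowShape S} (f : Hom x y),
      γ.app x ≫ A.nerveMap h f = G.map (X := x) (Y := y) f ≫ γ.app y :=
    fun γ x y f => (γ.naturality (X := x) (Y := y) f).symm
  ext x
  cases x with
  | edge a b => exact H a b
  | tri a b c =>
    apply CartesianMonoidalCategory.hom_ext
    · exact (nat α (.e01 a b c)).trans ((congrArg (_ ≫ ·) (H a b)).trans (nat β (.e01 a b c)).symm)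
    · exact (nat α (.e12 a b c)).trans ((congrArg (_ ≫ ·) (H b c)).trans (nat β (.e12 a b c)).symm)
  | tet a b c d =>
    apply CartesianMonoidalCategory.hom_ext
    · exact (nat α (.g01 a b c d)).trans
        ((congrArg (_ ≫ ·) (H a b)).trans (nat β (.g01 a b c d)).symm)
    · apply CartesianMonoidalCategory.hom_ext
      · exact (Category.assoc _ _ _).trans ((nat α (.g12 a b c d)).trans
          ((congrArg (_ ≫ ·) (H b c)).trans ((nat β (.g12 a b c d)).symm.trans
            (Category.assoc _ _ _).symm)))
      · exact (Category.assoc _ _ _).trans ((nat α (.g23 a b c d)).trans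
          ((congrArg (_ ≫ ·) (H c d)).trans ((nat β (.g23 a b c d)).symm.trans
            (Category.assoc _ _ _).symm)))

/-- The component at an edge of a map to a nerve. -/
def edgeApp (α : G ⟶ A.nerve h) (a b : S) : G.obj (edge a b) ⟶ A.Path (h a) (h b) :=
  α.app (edge a b)

theorem isMultiplicative_edgeApp (α : G ⟶ A.nerve h) : IsMultiplicative (edgeApp α) := by
  intro a b c
  have nat : ∀ {x y : FlowShape S} (f : Hom x y),
      G.map (X := x) (Y := y) f ≫ α.app y = α.app x ≫ A.nerveMap h f :=
    fun {x y} f => α.naturality (X := x) (Y := y) f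
  refine (nat (.e02 a b c)).trans (congrArg (· ≫ A.comp (h a) (h b) (h c)) ?_)
  apply CartesianMonoidalCategory.hom_ext
  · exact (nat (.e01 a b c)).symm.trans (lift_fst _ _).symm
  · exact (nat (.e12 a b c)).symm.trans (lift_snd _ _).symm

theorem isMultiplicative_nerve {B : EnrSemicat.{v} V} {k : S → B.Obj}
    (g : ∀ a b, A.Path (h a) (h b) ⟶ B.Path (k a) (k b))
    (hg : ∀ a b c, A.comp (h a) (h b) (h c) ≫ g a c =
      (g a b ⊗ₘ g b c) ≫ B.comp (k a) (k b) (k c)) :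
    IsMultiplicative (G := A.nerve h) g := by
  intro a b c
  refine (hg a b c).trans (congrArg (· ≫ B.comp (k a) (k b) (k c)) ?_)
  apply CartesianMonoidalCategory.hom_ext
  · exact (tensorHom_fst _ _).trans (lift_fst _ _).symm
  · exact (tensorHom_snd _ _).trans (lift_snd _ _).symm

/-- The map of nerves induced by a map of flows. -/
def nerveHom {B : EnrSemicat.{v} V} (q : A ⟶ B) (h : S → A.Obj) :
    A.nerve h ⟶ B.nerve fun s => q.obj (h s) :=
  toNerve (G := A.nerve h) (A := B) (fun a b => q.map (h a) (h b))
    (isMultiplicative_nerve _ fun a b c => q.map_comp (h a) (h b) (h c))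

end EnrSemicat

end Nerve

end

/-! ### The cells: generators on edges and the Segal condition -/

noncomputable section

section Cells

open FlowShape MorphismProperty

theorem rlp_sup_iff {C : Type*} [Category* C] (W₁ W₂ : MorphismProperty C) {X Y : C}
    (p : X ⟶ Y) : (W₁ ⊔ W₂).rlp p ↔ W₁.rlp p ∧ W₂.rlp p :=
  ⟨fun h => ⟨fun _ _ f hf => h f (Or.inl hf), fun _ _ f hf => h f (Or.inr hf)⟩,
    fun h _ _ f hf => hf.elim (h.1 f) (h.2 f)⟩

theorem rlp_ofHoms_iff {C : Type*} [Category* C] {ι : Type*} {s d : ι → C}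
    (f : ∀ i, s i ⟶ d i) {X Y : C} (p : X ⟶ Y) :
    (ofHoms f).rlp p ↔ ∀ i, HasLiftingProperty (f i) p :=
  ⟨fun h i => h _ ⟨i⟩, by rintro h _ _ _ ⟨i⟩; exact h i⟩

namespace FlowShape

variable {S : Type v}

/-- The edges of the spine of a triangle. -/
def triEdge (a b c : S) : ULift.{v} Bool → FlowShape S
  | ⟨false⟩ => edge a b
  | ⟨true⟩ => edge b c

/-- The inclusions of the edges of the spine of a triangle. -/
def triFace (a b c : S) : ∀ i, tri a b c ⟶ triEdge a b c i
  | ⟨false⟩ => Hom.e01 a b c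
  | ⟨true⟩ => Hom.e12 a b c

/-- The edges of the spine of a tetrahedron. -/
def tetEdge (a b c d : S) : ULift.{v} (Fin 3) → FlowShape S
  | ⟨0⟩ => edge a b
  | ⟨1⟩ => edge b c
  | ⟨2⟩ => edge c d

/-- The inclusions of the edges of the spine of a tetrahedron. -/
def tetFace (a b c d : S) : ∀ i, tet a b c d ⟶ tetEdge a b c d i
  | ⟨0⟩ => Hom.g01 a b c d
  | ⟨1⟩ => Hom.g12 a b c d
  | ⟨2⟩ => Hom.g23 a b c d

end FlowShape

variable {V : Type u} [Category.{v} V] {S : Type v} {G H : FlowShape S ⥤ V}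

/-- The map `p` is surjective on lifts of triangles with a lifted spine. -/
def TriLifting (p : G ⟶ H) (T : V) : Prop :=
  ∀ (a b c : S) (x : T ⟶ H.obj (tri a b c)) (y₁ : T ⟶ G.obj (edge a b))
    (y₂ : T ⟶ G.obj (edge b c)),
    y₁ ≫ p.app (edge a b) = x ≫ H.map (Y := edge a b) (Hom.e01 a b c) →
    y₂ ≫ p.app (edge b c) = x ≫ H.map (Y := edge b c) (Hom.e12 a b c) →
    ∃ z : T ⟶ G.obj (tri a b c), z ≫ p.app (tri a b c) = x ∧
      z ≫ G.map (Y := edge a b) (Hom.e01 a b c) = y₁ ∧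
      z ≫ G.map (Y := edge b c) (Hom.e12 a b c) = y₂

/-- The map `p` is injective on lifts of triangles with a lifted spine. -/
def TriSeparated (p : G ⟶ H) (T : V) : Prop :=
  ∀ (a b c : S) (z w : T ⟶ G.obj (tri a b c)),
    z ≫ p.app (tri a b c) = w ≫ p.app (tri a b c) →
    z ≫ G.map (Y := edge a b) (Hom.e01 a b c) = w ≫ G.map (Y := edge a b) (Hom.e01 a b c) →
    z ≫ G.map (Y := edge b c) (Hom.e12 a b c) = w ≫ G.map (Y := edge b c) (Hom.e12 a b c) →
    z = w

/-- The map `p` is surjective on lifts of tetrahedra with a lifted spine. -/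
def TetLifting (p : G ⟶ H) (T : V) : Prop :=
  ∀ (a b c d : S) (x : T ⟶ H.obj (tet a b c d)) (y₁ : T ⟶ G.obj (edge a b))
    (y₂ : T ⟶ G.obj (edge b c)) (y₃ : T ⟶ G.obj (edge c d)),
    y₁ ≫ p.app (edge a b) = x ≫ H.map (Y := edge a b) (Hom.g01 a b c d) →
    y₂ ≫ p.app (edge b c) = x ≫ H.map (Y := edge b c) (Hom.g12 a b c d) →
    y₃ ≫ p.app (edge c d) = x ≫ H.map (Y := edge c d) (Hom.g23 a b c d) →
    ∃ z : T ⟶ G.obj (tet a b c d), z ≫ p.app (tet a b c d) = x ∧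
      z ≫ G.map (Y := edge a b) (Hom.g01 a b c d) = y₁ ∧
      z ≫ G.map (Y := edge b c) (Hom.g12 a b c d) = y₂ ∧
      z ≫ G.map (Y := edge c d) (Hom.g23 a b c d) = y₃

variable [HasColimitsOfSize.{v, v} V]

theorem hasLiftingProperty_triFace_iff (p : G ⟶ H) (T : V) :
    (∀ a b c, HasLiftingProperty (coneMap (triFace a b c) T) p) ↔ TriLifting p T := by
  simp only [hasLiftingProperty_coneMap_iff]
  constructor
  · intro h a b c x y₁ y₂ h₁ h₂
    obtain ⟨z, hz, hz'⟩ := h a b c x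
      (fun i => match i with
        | ⟨false⟩ => y₁
        | ⟨true⟩ => y₂)
      (by rintro ⟨_ | _⟩ <;> assumption)
    exact ⟨z, hz, hz' ⟨false⟩, hz' ⟨true⟩⟩
  · intro h a b c x y hy
    obtain ⟨z, hz, h₁, h₂⟩ := h a b c x (y ⟨false⟩) (y ⟨true⟩) (hy ⟨false⟩) (hy ⟨true⟩)
    exact ⟨z, hz, by rintro ⟨_ | _⟩ <;> assumption⟩

theorem hasLiftingProperty_relCodiag_triFace_iff (p : G ⟶ H) (T : V) :
    (∀ a b c, HasLiftingProperty (relCodiag (coneMap (triFace a b c) T)) p) ↔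
      TriSeparated p T := by
  simp only [hasLiftingProperty_relCodiag_coneMap_iff]
  constructor
  · intro h a b c z z' h₀ h₁ h₂
    exact h a b c z z' h₀ (by rintro ⟨_ | _⟩ <;> assumption)
  · intro h a b c z z' h₀ h₁
    exact h a b c z z' h₀ (h₁ ⟨false⟩) (h₁ ⟨true⟩)

theorem hasLiftingProperty_tetFace_iff (p : G ⟶ H) (T : V) :
    (∀ a b c d, HasLiftingProperty (coneMap (tetFace a b c d) T) p) ↔ TetLifting p T := by
  simp only [hasLiftingProperty_coneMap_iff]
  constructor
  · intro h a b c d x y₁ y₂ y₃ h₁ h₂ h₃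
    obtain ⟨z, hz, hz'⟩ := h a b c d x
      (fun i => match i with
        | ⟨0⟩ => y₁
        | ⟨1⟩ => y₂
        | ⟨2⟩ => y₃)
      (by rintro ⟨i⟩; fin_cases i <;> assumption)
    exact ⟨z, hz, hz' ⟨0⟩, hz' ⟨1⟩, hz' ⟨2⟩⟩
  · intro h a b c d x y hy
    obtain ⟨z, hz, h₁, h₂, h₃⟩ := h a b c d x (y ⟨0⟩) (y ⟨1⟩) (y ⟨2⟩) (hy ⟨0⟩) (hy ⟨1⟩) (hy ⟨2⟩)
    exact ⟨z, hz, by rintro ⟨i⟩; fin_cases i <;> assumption⟩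

variable (S) in
/-- The maps generating the Segal condition for diagrams of shape `FlowShape S`, together with
the free maps on the edges generated by a family of maps. -/
def flowCells (Q : ObjectProperty V) {ι : Type} {s d : ι → V} (i : ∀ n, s n ⟶ d n) :
    MorphismProperty (FlowShape S ⥤ V) :=
  (ofHoms (fun x : (S × S) × ι => (evaluationLeftAdjoint V (edge x.1.1 x.1.2)).map (i x.2)) ⊔
    ofHoms (fun x : (S × S × S) × Subtype Q =>
      coneMap (triFace x.1.1 x.1.2.1 x.1.2.2) x.2.1)) ⊔
  (ofHoms (fun x : (S × S × S) × Subtype Q =>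
      relCodiag (coneMap (triFace x.1.1 x.1.2.1 x.1.2.2) x.2.1)) ⊔
    ofHoms (fun x : (S × S × S × S) × Subtype Q =>
      coneMap (tetFace x.1.1 x.1.2.1 x.1.2.2.1 x.1.2.2.2) x.2.1))

variable (Q : ObjectProperty V) {ι : Type} {s d : ι → V} (i : ∀ n, s n ⟶ d n)

theorem rlp_flowCells_iff (p : G ⟶ H) : (flowCells S Q i).rlp p ↔
    (∀ n a b, HasLiftingProperty (i n) (p.app (edge a b))) ∧
      ∀ T, Q T → TriLifting p T ∧ TriSeparated p T ∧ TetLifting p T := by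
  simp only [← hasLiftingProperty_triFace_iff, ← hasLiftingProperty_relCodiag_triFace_iff,
    ← hasLiftingProperty_tetFace_iff]
  have key : ∀ n a b, HasLiftingProperty ((evaluationLeftAdjoint V (edge a b)).map (i n)) p ↔
      HasLiftingProperty (i n) (p.app (edge a b)) := fun n a b =>
    (evaluationAdjunctionRight V (edge a b)).hasLiftingProperty_iff (i n) p
  simp only [← key, flowCells, rlp_sup_iff, rlp_ofHoms_iff, Prod.forall, Subtype.forall]
  exact ⟨fun ⟨⟨h₁, h₂⟩, h₃, h₄⟩ => ⟨fun n a b => h₁ a b n, fun T hT => ⟨fun a b c => h₂ a b c T hT,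
      fun a b c => h₃ a b c T hT, fun a b c d => h₄ a b c d T hT⟩⟩,
    fun ⟨h₁, h₂⟩ => ⟨⟨fun a b n => h₁ n a b, fun a b c T hT => (h₂ T hT).1 a b c⟩,
      fun a b c T hT => (h₂ T hT).2.1 a b c, fun a b c d T hT => (h₂ T hT).2.2 a b c d⟩⟩

/-- The family is small since `Q`, `ι` and the set of states are. The sources are presentable, being
small colimits of free diagrams. -/
theorem hasFactorization_flowCells [IsLocallyPresentable.{v} V] [ObjectProperty.Small.{v} Q]
    [Small.{v} ι] :
    HasFactorization (flowCells S Q i).rlp.llp (flowCells S Q i).rlp := by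
  have hsmall : Small.{v} (Subtype Q) := ‹ObjectProperty.Small.{v} Q›
  have h₁ : IsSmall.{v} (flowCells S Q i) :=
    @isSmall_sup _ _ _ _ (isSmall_sup _ _) (isSmall_sup _ _)
  have h₂ := hasSmallObjectArgument_of_isPresentable (flowCells S Q i) (by
    rintro _ _ _ ((⟨⟨⟨a, b⟩, n⟩⟩ | ⟨⟨⟨a, b, c⟩, T⟩⟩) |
      (⟨⟨⟨a, b, c⟩, T⟩⟩ | ⟨⟨⟨a, b, c, d⟩, T⟩⟩))
    · exact isPresentable_free _ _
    · exact isPresentable_coneMap_source _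
    · exact isPresentable_pushout _ _ (isPresentable_coneMap_source _) (isPresentable_free _ _)
        (isPresentable_free _ _)
    · exact isPresentable_coneMap_source _)
  infer_instance

end Cells

end

/-! ### Flows from diagrams satisfying the Segal condition -/

noncomputable section

section Segal

open FlowShape MorphismProperty

variable {V : Type u} [Category.{v} V] [CartesianMonoidalCategory V] {S : Type v}
  {Q : ObjectProperty V} {G : FlowShape S ⥤ V}

/-- The Segal condition, tested on the objects of `Q` for tetrahedra. -/
structure IsSegal (Q : ObjectProperty V) (G : FlowShape S ⥤ V) : Prop where
  isIso_tri (a b c : S) : IsIso (lift (G.map (X := tri a b c) (Y := edge a b) (Hom.e01 a b c))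
    (G.map (Y := edge b c) (Hom.e12 a b c)))
  exists_tet (a b c d : S) {T : V} (hT : Q T) (y₁ : T ⟶ G.obj (edge a b))
    (y₂ : T ⟶ G.obj (edge b c)) (y₃ : T ⟶ G.obj (edge c d)) :
    ∃ z : T ⟶ G.obj (tet a b c d), z ≫ G.map (Y := edge a b) (Hom.g01 a b c d) = y₁ ∧
      z ≫ G.map (Y := edge b c) (Hom.g12 a b c d) = y₂ ∧
      z ≫ G.map (Y := edge c d) (Hom.g23 a b c d) = y₃

namespace EnrSemicat

variable {A B : EnrSemicat.{v} V} {k : S → B.Obj} (p : G ⟶ B.nerve k)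

/-- In the nerve any two consecutive edges bound a triangle, so a relative filling condition over a
nerve becomes an absolute one. -/
theorem exists_tri_of_triLifting {T : V} (hp : TriLifting p T) {a b c : S}
    (y₁ : T ⟶ G.obj (edge a b)) (y₂ : T ⟶ G.obj (edge b c)) :
    ∃ z : T ⟶ G.obj (tri a b c), z ≫ G.map (Y := edge a b) (Hom.e01 a b c) = y₁ ∧
      z ≫ G.map (Y := edge b c) (Hom.e12 a b c) = y₂ := by
  obtain ⟨z, -, h₁, h₂⟩ := hp a b c (lift (y₁ ≫ edgeApp p a b) (y₂ ≫ edgeApp p b c)) y₁ y₂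
    (lift_fst (y₁ ≫ edgeApp p a b) (y₂ ≫ edgeApp p b c)).symm
    (lift_snd (y₁ ≫ edgeApp p a b) (y₂ ≫ edgeApp p b c)).symm
  exact ⟨z, h₁, h₂⟩

theorem exists_tet_of_tetLifting {T : V} (hp : TetLifting p T) {a b c d : S}
    (y₁ : T ⟶ G.obj (edge a b)) (y₂ : T ⟶ G.obj (edge b c)) (y₃ : T ⟶ G.obj (edge c d)) :
    ∃ z : T ⟶ G.obj (tet a b c d), z ≫ G.map (Y := edge a b) (Hom.g01 a b c d) = y₁ ∧
      z ≫ G.map (Y := edge b c) (Hom.g12 a b c d) = y₂ ∧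
      z ≫ G.map (Y := edge c d) (Hom.g23 a b c d) = y₃ := by
  let x := lift (y₁ ≫ edgeApp p a b) (lift (y₂ ≫ edgeApp p b c) (y₃ ≫ edgeApp p c d))
  have h₁ : y₁ ≫ edgeApp p a b = x ≫ fst _ _ := (lift_fst _ _).symm
  have h₂ : y₂ ≫ edgeApp p b c = x ≫ snd _ _ ≫ fst _ _ := by
    rw [lift_snd_assoc, lift_fst]
  have h₃ : y₃ ≫ edgeApp p c d = x ≫ snd _ _ ≫ snd _ _ := by
    rw [lift_snd_assoc, lift_snd]
  obtain ⟨z, -, h⟩ := hp a b c d x y₁ y₂ y₃ h₁ h₂ h₃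
  exact ⟨z, h⟩

theorem nerve_tri_hom_ext {h : S → A.Obj} {a b c : S} {T : V}
    {z z' : T ⟶ (A.nerve h).obj (tri a b c)}
    (h₁ : z ≫ (A.nerve h).map (Y := edge a b) (Hom.e01 a b c) =
      z' ≫ (A.nerve h).map (Y := edge a b) (Hom.e01 a b c))
    (h₂ : z ≫ (A.nerve h).map (Y := edge b c) (Hom.e12 a b c) =
      z' ≫ (A.nerve h).map (Y := edge b c) (Hom.e12 a b c)) : z = z' :=
  CartesianMonoidalCategory.hom_ext (X := A.Path (h a) (h b)) (Y := A.Path (h b) (h c)) _ _ h₁ h₂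

theorem nerve_tet_hom_ext {h : S → A.Obj} {a b c d : S} {T : V}
    {z z' : T ⟶ (A.nerve h).obj (tet a b c d)}
    (h₁ : z ≫ (A.nerve h).map (Y := edge a b) (Hom.g01 a b c d) =
      z' ≫ (A.nerve h).map (Y := edge a b) (Hom.g01 a b c d))
    (h₂ : z ≫ (A.nerve h).map (Y := edge b c) (Hom.g12 a b c d) =
      z' ≫ (A.nerve h).map (Y := edge b c) (Hom.g12 a b c d))
    (h₃ : z ≫ (A.nerve h).map (Y := edge c d) (Hom.g23 a b c d) =
      z' ≫ (A.nerve h).map (Y := edge c d) (Hom.g23 a b c d)) : z = z' := by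
  refine CartesianMonoidalCategory.hom_ext (X := A.Path (h a) (h b))
    (Y := A.Path (h b) (h c) ⊗ A.Path (h c) (h d)) _ _ h₁ ?_
  refine CartesianMonoidalCategory.hom_ext (X := A.Path (h b) (h c)) (Y := A.Path (h c) (h d))
    _ _ ?_ ?_
  · exact (Category.assoc _ _ _).trans (h₂.trans (Category.assoc _ _ _).symm)
  · exact (Category.assoc _ _ _).trans (h₃.trans (Category.assoc _ _ _).symm)

theorem triLifting_nerve {h : S → A.Obj} (p : A.nerve h ⟶ B.nerve k) (T : V) :
    TriLifting p T := by
  intro a b c x y₁ y₂ h₁ h₂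
  let z : T ⟶ (A.nerve h).obj (tri a b c) :=
    lift (X := A.Path (h a) (h b)) (Y := A.Path (h b) (h c)) y₁ y₂
  have hz₁ : z ≫ (A.nerve h).map (Y := edge a b) (Hom.e01 a b c) = y₁ :=
    lift_fst (X := A.Path (h a) (h b)) (Y := A.Path (h b) (h c)) y₁ y₂
  have hz₂ : z ≫ (A.nerve h).map (Y := edge b c) (Hom.e12 a b c) = y₂ :=
    lift_snd (X := A.Path (h a) (h b)) (Y := A.Path (h b) (h c)) y₁ y₂
  refine ⟨z, nerve_tri_hom_ext ?_ ?_, hz₁, hz₂⟩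
  · rw [Category.assoc, ← p.naturality, ← Category.assoc, hz₁, h₁]
  · rw [Category.assoc, ← p.naturality, ← Category.assoc, hz₂, h₂]

theorem tetLifting_nerve {h : S → A.Obj} (p : A.nerve h ⟶ B.nerve k) (T : V) :
    TetLifting p T := by
  intro a b c d x y₁ y₂ y₃ h₁ h₂ h₃
  let z : T ⟶ (A.nerve h).obj (tet a b c d) :=
    lift (X := A.Path (h a) (h b)) (Y := A.Path (h b) (h c) ⊗ A.Path (h c) (h d)) y₁
      (lift (X := A.Path (h b) (h c)) (Y := A.Path (h c) (h d)) y₂ y₃)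
  have hz₁ : z ≫ (A.nerve h).map (Y := edge a b) (Hom.g01 a b c d) = y₁ :=
    lift_fst (X := A.Path (h a) (h b)) (Y := A.Path (h b) (h c) ⊗ A.Path (h c) (h d)) y₁ _
  have hz₂ : z ≫ (A.nerve h).map (Y := edge b c) (Hom.g12 a b c d) = y₂ :=
    (lift_snd_assoc (X := A.Path (h a) (h b)) (Y := A.Path (h b) (h c) ⊗ A.Path (h c) (h d))
      y₁ _ _).trans (lift_fst (X := A.Path (h b) (h c)) (Y := A.Path (h c) (h d)) y₂ y₃)
  have hz₃ : z ≫ (A.nerve h).map (Y := edge c d) (Hom.g23 a b c d) = y₃ :=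
    (lift_snd_assoc (X := A.Path (h a) (h b)) (Y := A.Path (h b) (h c) ⊗ A.Path (h c) (h d))
      y₁ _ _).trans (lift_snd (X := A.Path (h b) (h c)) (Y := A.Path (h c) (h d)) y₂ y₃)
  refine ⟨z, nerve_tet_hom_ext ?_ ?_ ?_, hz₁, hz₂, hz₃⟩
  · rw [Category.assoc, ← p.naturality, ← Category.assoc, hz₁, h₁]
  · rw [Category.assoc, ← p.naturality, ← Category.assoc, hz₂, h₂]
  · rw [Category.assoc, ← p.naturality, ← Category.assoc, hz₃, h₃]

/-- Fillers in a nerve exist and are unique, so the Segal cells impose nothing on maps between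
nerves and only the edges matter. -/
theorem rlp_flowCells_nerve [HasColimitsOfSize.{v, v} V] (Q : ObjectProperty V) {ι : Type}
    {s d : ι → V} (i : ∀ n, s n ⟶ d n) {h : S → A.Obj} (p : A.nerve h ⟶ B.nerve k)
    (hp : ∀ n a b, HasLiftingProperty (i n) (edgeApp p a b)) : (flowCells S Q i).rlp p :=
  (rlp_flowCells_iff Q i p).2 ⟨hp, fun T _ => ⟨triLifting_nerve p T,
    fun _ _ _ _ _ _ h₁ h₂ => nerve_tri_hom_ext h₁ h₂, tetLifting_nerve p T⟩⟩

/-- Uniqueness of fillers, tested on the separating family `Q`, makes the spine map of a triangle a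
monomorphism; existence lets every `Q`-element of the product factor through it. A strong generator
detects that such a monomorphism is invertible. -/
theorem isSegal_of_lifting (hQ : Q.IsStrongGenerator)
    (hp : ∀ T, Q T → TriLifting p T ∧ TriSeparated p T ∧ TetLifting p T) : IsSegal Q G where
  isIso_tri a b c := by
    have : Mono (lift (G.map (X := tri a b c) (Y := edge a b) (Hom.e01 a b c))
        (G.map (Y := edge b c) (Hom.e12 a b c))) := by
      rw [hQ.isSeparating.mono_iff]
      intro T hT z z' hz
      have h₁ := hz =≫ fst _ _
      have h₂ := hz =≫ snd _ _
      simp only [Category.assoc, lift_fst, lift_snd] at h₁ h₂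
      refine (hp T hT).2.1 a b c z z' (nerve_tri_hom_ext ?_ ?_) h₁ h₂
      · rw [Category.assoc, Category.assoc, ← p.naturality, ← Category.assoc, h₁, Category.assoc]
      · rw [Category.assoc, Category.assoc, ← p.naturality, ← Category.assoc, h₂, Category.assoc]
    refine hQ.isIso_of_mono _ fun T hT y => ?_
    obtain ⟨z, h₁, h₂⟩ := exists_tri_of_triLifting p (hp T hT).1 (y ≫ fst _ _) (y ≫ snd _ _)
    refine ⟨z, CartesianMonoidalCategory.hom_ext _ _ ?_ ?_⟩
    · simpa using h₁
    · simpa using h₂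
  exists_tet _ _ _ _ _ hT y₁ y₂ y₃ := exists_tet_of_tetLifting p (hp _ hT).2.2 y₁ y₂ y₃

end EnrSemicat

namespace IsSegal

variable (hG : IsSegal Q G)

/-- The composition of edges in a diagram satisfying the Segal condition. -/
def comp (a b c : S) : G.obj (edge a b) ⊗ G.obj (edge b c) ⟶ G.obj (edge a c) :=
  have := hG.isIso_tri a b c
  inv (lift (G.map (X := tri a b c) (Y := edge a b) (Hom.e01 a b c))
    (G.map (Y := edge b c) (Hom.e12 a b c))) ≫ G.map (Y := edge a c) (Hom.e02 a b c)

theorem lift_comp (a b c : S) : lift (G.map (X := tri a b c) (Y := edge a b) (Hom.e01 a b c))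
    (G.map (Y := edge b c) (Hom.e12 a b c)) ≫ hG.comp a b c =
      G.map (Y := edge a c) (Hom.e02 a b c) := by
  have := hG.isIso_tri a b c
  rw [comp, IsIso.hom_inv_id_assoc]

theorem lift_map_comp {x : FlowShape S} {a b c : S} {T : V} (t : T ⟶ G.obj x)
    (m : FlowShape.Hom x (tri a b c)) :
    lift (t ≫ G.map (Y := edge a b) (m.comp (.e01 a b c)))
      (t ≫ G.map (Y := edge b c) (m.comp (.e12 a b c))) ≫ hG.comp a b c =
        t ≫ G.map (Y := edge a c) (m.comp (.e02 a b c)) := by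
  have e : ∀ {y : FlowShape S} (n : FlowShape.Hom (tri a b c) y),
      G.map (X := x) (Y := y) (m.comp n) = G.map (X := x) (Y := tri a b c) m ≫ G.map (Y := y) n :=
    fun {y} n => G.map_comp (X := x) (Y := tri a b c) (Z := y) m n
  rw [e, e, e, ← hG.lift_comp a b c, ← comp_lift_assoc, ← comp_lift_assoc]

/-- Tested on `Q`-elements, three consecutive edges span a tetrahedron, and both bracketings equal
its long edge. Only existence of the tetrahedron is needed, which is why no uniqueness cells are
attached for tetrahedra. -/
theorem comp_assoc (hQ : Q.IsSeparating) (a b c d : S) :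
    hG.comp a b c ▷ G.obj (edge c d) ≫ hG.comp a c d =
      (α_ (G.obj (edge a b)) (G.obj (edge b c)) (G.obj (edge c d))).hom ≫
        G.obj (edge a b) ◁ hG.comp b c d ≫ hG.comp a b d := by
  refine hQ _ _ fun T hT w => ?_
  obtain ⟨t, h₁, h₂, h₃⟩ := hG.exists_tet a b c d hT (w ≫ fst _ _ ≫ fst _ _)
    (w ≫ fst _ _ ≫ snd _ _) (w ≫ snd _ _)
  have hw : w = lift (lift (t ≫ G.map (Y := edge a b) (Hom.g01 a b c d))
      (t ≫ G.map (Y := edge b c) (Hom.g12 a b c d)))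
      (t ≫ G.map (Y := edge c d) (Hom.g23 a b c d)) := by
    rw [h₁, h₂, h₃]
    ext <;> simp
  rw [hw, lift_whiskerRight_assoc, lift_lift_associator_hom_assoc, lift_whiskerLeft_assoc]
  -- The four triangular faces: `e₁` and `e₂` compute one bracketing, `e₃` and `e₄` the other.
  have e₁ := hG.lift_map_comp t (.f012 a b c d)
  have e₂ := hG.lift_map_comp t (.f023 a b c d)
  have e₃ := hG.lift_map_comp t (.f123 a b c d)
  have e₄ := hG.lift_map_comp t (.f013 a b c d)
  exact (congrArg (fun s => lift s _ ≫ hG.comp a c d) e₁).trans (e₂.trans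
    (e₄.symm.trans (congrArg (fun s => lift _ s ≫ hG.comp a b d) e₃).symm))

/-- The flow associated with a diagram satisfying the Segal condition. -/
@[reducible]
def flow (hQ : Q.IsSeparating) : EnrSemicat.{v} V where
  Obj := S
  Path a b := G.obj (edge a b)
  comp := hG.comp
  assoc := hG.comp_assoc hQ

/-- Multiplicative maps are the maps compatible with the composition. -/
theorem isMultiplicative_iff {A : EnrSemicat.{v} V} {h : S → A.Obj}
    (g : ∀ a b, G.obj (edge a b) ⟶ A.Path (h a) (h b)) :
    EnrSemicat.IsMultiplicative g ↔ ∀ a b c, hG.comp a b c ≫ g a c =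
      (g a b ⊗ₘ g b c) ≫ A.comp (h a) (h b) (h c) := by
  refine forall_congr' fun a => forall_congr' fun b => forall_congr' fun c => ?_
  have := hG.isIso_tri a b c
  rw [← cancel_epi (lift (G.map (X := tri a b c) (Y := edge a b) (Hom.e01 a b c))
    (G.map (Y := edge b c) (Hom.e12 a b c))), ← Category.assoc, hG.lift_comp, lift_map_assoc]

end IsSegal

end Segal

end

/-! ### Diagrams generated by a flow, and the factorization -/

noncomputable section

namespace EnrSemicat

open FlowShape MorphismProperty

section Extension

variable {V : Type u} [Category.{v} V] [CartesianMonoidalCategory V] {R S : Type v}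
  (X : EnrSemicat.{v} V)

/-- The components of the comparison of a nerve with a restricted nerve. -/
def nerveRestrictApp {B : EnrSemicat.{v} V} (k : S → B.Obj) (g : R → S) :
    ∀ x : FlowShape R, B.nerveObj (fun r => k (g r)) x ≅ B.nerveObj k (x.mapObj g)
  | edge _ _ => Iso.refl _
  | tri _ _ _ => Iso.refl _
  | tet _ _ _ _ => Iso.refl _

theorem nerveRestrictApp_naturality {B : EnrSemicat.{v} V} (k : S → B.Obj) (g : R → S)
    {x y : FlowShape R} (f : FlowShape.Hom x y) :
    B.nerveMap (fun r => k (g r)) f ≫ (nerveRestrictApp k g y).hom =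
      (nerveRestrictApp k g x).hom ≫ B.nerveMap k (Hom.map g f) := by
  cases f
  case id => exact (Category.id_comp _).trans (Category.comp_id _).symm
  all_goals exact (Category.comp_id _).trans (Category.id_comp _).symm

/-- Nerves are compatible with the restriction along maps of sets of states. -/
def nerveRestrict {B : EnrSemicat.{v} V} (k : S → B.Obj) (g : R → S) :
    B.nerve (fun r => k (g r)) ≅ FlowShape.map g ⋙ B.nerve k :=
  NatIso.ofComponents (nerveRestrictApp k g) fun f => nerveRestrictApp_naturality k g f

variable [HasColimitsOfSize.{v, v} V] (g : X.Obj → S)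

/-- The diagram generated by a flow along a map from its set of states. -/
def ext : FlowShape S ⥤ V := (FlowShape.map g).lan.obj (X.nerve fun a => a)

/-- The canonical map to the generated diagram. -/
def extUnit : X.nerve (fun a => a) ⟶ FlowShape.map g ⋙ X.ext g :=
  (FlowShape.map g).lanUnit.app (X.nerve fun a => a)

/-- The canonical map from the paths of a flow to the generated diagram. -/
def extι (a b : X.Obj) : X.Path a b ⟶ (X.ext g).obj (edge (g a) (g b)) :=
  (X.extUnit g).app (edge a b)

variable {X g}

/-- The generated diagram need not be Segal, so multiplicativity is stated only after a map to a
Segal diagram. There, the image of the triangle of `X` on `a`, `b`, `c` expresses the composition.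
-/
theorem comp_extι {G : FlowShape S ⥤ V} (γ : X.ext g ⟶ G) {Q : ObjectProperty V}
    (hG : IsSegal Q G) (a b c : X.Obj) :
    X.comp a b c ≫ X.extι g a c ≫ γ.app (edge (g a) (g c)) =
      ((X.extι g a b ≫ γ.app (edge (g a) (g b))) ⊗ₘ
        (X.extι g b c ≫ γ.app (edge (g b) (g c)))) ≫ hG.comp (g a) (g b) (g c) := by
  let δ : X.nerve (fun a => a) ⟶ FlowShape.map g ⋙ G :=
    X.extUnit g ≫ Functor.whiskerLeft (FlowShape.map g) γ
  let t : X.Path a b ⊗ X.Path b c ⟶ G.obj (tri (g a) (g b) (g c)) := δ.app (tri a b c)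
  have h₁ : fst (X.Path a b) (X.Path b c) ≫ X.extι g a b ≫ γ.app (edge (g a) (g b)) =
      t ≫ G.map (X := tri (g a) (g b) (g c)) (Y := edge (g a) (g b))
        (Hom.e01 (g a) (g b) (g c)) :=
    δ.naturality (X := tri a b c) (Y := edge a b) (Hom.e01 a b c)
  have h₂ : snd (X.Path a b) (X.Path b c) ≫ X.extι g b c ≫ γ.app (edge (g b) (g c)) =
      t ≫ G.map (X := tri (g a) (g b) (g c)) (Y := edge (g b) (g c))
        (Hom.e12 (g a) (g b) (g c)) :=
    δ.naturality (X := tri a b c) (Y := edge b c) (Hom.e12 a b c)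
  have h₃ : X.comp a b c ≫ X.extι g a c ≫ γ.app (edge (g a) (g c)) =
      t ≫ G.map (X := tri (g a) (g b) (g c)) (Y := edge (g a) (g c))
        (Hom.e02 (g a) (g b) (g c)) :=
    δ.naturality (X := tri a b c) (Y := edge a c) (Hom.e02 a b c)
  rw [h₃, ← hG.lift_comp, ← Category.assoc, comp_lift]
  refine congrArg (· ≫ hG.comp (g a) (g b) (g c)) ?_
  apply CartesianMonoidalCategory.hom_ext
  · rw [lift_fst, tensorHom_fst]
    exact h₁.symm
  · rw [lift_snd, tensorHom_snd]
    exact h₂.symm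

variable {B : EnrSemicat.{v} V} {k : S → B.Obj}

/-- The universal property of the left Kan extension, combined with the description of maps to a
nerve. With `ext_hom_ext`, maps from the generated diagram to a nerve amount to maps of flows out of
`X` with prescribed states. -/
theorem exists_ext_desc (m : ∀ a b, X.Path a b ⟶ B.Path (k (g a)) (k (g b)))
    (hm : ∀ a b c, X.comp a b c ≫ m a c =
      (m a b ⊗ₘ m b c) ≫ B.comp (k (g a)) (k (g b)) (k (g c))) :
    ∃ α : X.ext g ⟶ B.nerve k, ∀ a b, X.extι g a b ≫ edgeApp α (g a) (g b) = m a b := by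
  let β : X.nerve (fun a => a) ⟶ FlowShape.map g ⋙ B.nerve k :=
    toNerve (G := X.nerve fun a => a) (A := B) (h := fun a => k (g a)) m
      (isMultiplicative_nerve (A := X) (h := fun a => a) (k := fun a => k (g a)) m hm) ≫
        (nerveRestrict k g).hom
  let α : X.ext g ⟶ B.nerve k := (((FlowShape.map g).lanAdjunction V).homEquiv _ _).symm β
  have hα : X.extUnit g ≫ Functor.whiskerLeft (FlowShape.map g) α = β := by
    have := (((FlowShape.map g).lanAdjunction V).homEquiv _ _).apply_symm_apply β
    rw [Adjunction.homEquiv_unit, Functor.lanAdjunction_unit] at this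
    exact this
  exact ⟨α, fun a b => (NatTrans.congr_app hα (edge a b)).trans (Category.comp_id (m a b))⟩

theorem ext_hom_ext {α β : X.ext g ⟶ B.nerve k}
    (H : ∀ a b, X.extι g a b ≫ edgeApp α (g a) (g b) = X.extι g a b ≫ edgeApp β (g a) (g b)) :
    α = β := by
  refine Functor.hom_ext_of_isLeftKanExtension _
    ((FlowShape.map g).lanUnit.app (X.nerve fun a => a)) α β ?_
  rw [← cancel_mono (nerveRestrict k g).inv]
  refine nerve_hom_ext (A := B) (h := fun a => k (g a)) fun a b => ?_
  exact (Category.comp_id (X.extι g a b ≫ edgeApp α (g a) (g b))).trans ((H a b).trans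
    (Category.comp_id (X.extι g a b ≫ edgeApp β (g a) (g b))).symm)

end Extension

section Factorization

variable {V : Type u} [Category.{v} V] [CartesianMonoidalCategory V] [IsLocallyPresentable.{v} V]

theorem exists_small_isStrongGenerator (V : Type u) [Category.{v} V]
    [IsLocallyPresentable.{v} V] :
    ∃ (Q : ObjectProperty V) (_ : ObjectProperty.Small.{v} Q), Q.IsStrongGenerator := by
  obtain ⟨κ, _, _⟩ := IsLocallyPresentable.exists_cardinal.{v} V
  obtain ⟨Q, _, hQ⟩ := HasCardinalFilteredGenerator.exists_small_generator V κ
  exact ⟨Q, inferInstance, hQ.isStrongGenerator⟩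

/-- Every map of flows is a map with the left lifting property with respect to the maps which
are surjective on states and have a given right lifting property on paths, followed by such a
map. -/
theorem exists_factorization {ι : Type} [Small.{v} ι] {s d : ι → V} (i : ∀ n, s n ⟶ d n)
    {X Y : EnrSemicat.{v} V} (f : X ⟶ Y) :
    ∃ (Z : EnrSemicat.{v} V) (j : X ⟶ Z) (q : Z ⟶ Y), j ≫ q = f ∧
      (Function.Surjective q.obj ∧ ∀ n a b, HasLiftingProperty (i n) (q.map a b)) ∧
      ∀ {A B : EnrSemicat.{v} V} (p : A ⟶ B), Function.Surjective p.obj →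
        (∀ n a b, HasLiftingProperty (i n) (p.map a b)) → HasLiftingProperty j p := by
  obtain ⟨Q, _, hQ⟩ := exists_small_isStrongGenerator V
  obtain ⟨fo, fm, fc⟩ := f
  -- Adjoining all states of `Y` makes the first factor injective and the second surjective on
  -- states; the set of states is not changed afterwards.
  let φ : X.Obj ⊕ Y.Obj → Y.Obj := Sum.elim fo fun y => y
  obtain ⟨ω, hω⟩ := exists_ext_desc (X := X) (g := Sum.inl) (B := Y) (k := φ) fm fc
  have := hasFactorization_flowCells (S := X.Obj ⊕ Y.Obj) Q i
  obtain ⟨G, l, r, fac, hl, hr⟩ :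
      ∃ (G : FlowShape (X.Obj ⊕ Y.Obj) ⥤ V) (l : X.ext Sum.inl ⟶ G) (r : G ⟶ Y.nerve φ),
        l ≫ r = ω ∧ (flowCells _ Q i).rlp.llp l ∧ (flowCells _ Q i).rlp r :=
    let D := factorizationData (flowCells _ Q i).rlp.llp (flowCells _ Q i).rlp ω
    ⟨D.Z, D.i, D.p, D.fac, D.hi, D.hp⟩
  rw [rlp_flowCells_iff] at hr
  -- The Segal cells in the small object argument make the middle diagram come from a flow.
  have hG : IsSegal Q G := isSegal_of_lifting r hQ hr.2
  let j : X ⟶ hG.flow hQ.isSeparating :=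
    { obj := Sum.inl
      map := fun a b => X.extι Sum.inl a b ≫ l.app (edge (Sum.inl a) (Sum.inl b))
      map_comp := comp_extι l hG }
  let q : hG.flow hQ.isSeparating ⟶ Y :=
    { obj := φ
      map := edgeApp r
      map_comp := (hG.isMultiplicative_iff _).1 (isMultiplicative_edgeApp r) }
  refine ⟨_, j, q, ?_, ⟨fun y => ⟨Sum.inr y, rfl⟩, hr.1⟩, ?_⟩
  · refine hom_ext' (X := X) (Y := Y) (o := fo) fun a b => ?_
    subst fac
    exact (Category.assoc _ _ _).trans (hω a b)
  · intro A B p hp hp'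
    -- With a lift `h` on states fixed, the square of flows becomes a square of diagrams on the same
    -- set of states, from `l` to the map of nerves induced by `p`.
    refine hasLiftingProperty_of_obj j Sum.inl_injective p hp ?_
    intro h um uc vm vc comm
    let ν : G ⟶ B.nerve fun s => p.obj (h s) :=
      toNerve (A := B) (h := fun s => p.obj (h s)) vm ((hG.isMultiplicative_iff _).2 vc)
    obtain ⟨μ, hμ⟩ := exists_ext_desc (X := X) (g := Sum.inl) (B := A) (k := h) um uc
    have sq : CommSq μ l (nerveHom p h) ν := by
      refine ⟨ext_hom_ext fun a b => ?_⟩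
      refine (Category.assoc _ _ _).symm.trans ?_
      refine (congrArg (· ≫ p.map _ _) (hμ a b)).trans ?_
      exact (comm a b).trans (Category.assoc _ _ _)
    have : HasLiftingProperty l (nerveHom p h) :=
      hl _ (rlp_flowCells_nerve Q i _ fun n a b => hp' n (h a) (h b))
    -- A map of diagrams from `G` to a nerve is multiplicative on edges, hence a map of flows.
    refine ⟨{ obj := h
              map := edgeApp sq.lift
              map_comp := (hG.isMultiplicative_iff _).1 (isMultiplicative_edgeApp sq.lift) },
      ?_, ?_⟩
    · refine hom_ext' (X := X) (Y := A) (o := fun a => h (Sum.inl a)) fun a b => ?_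
      rw [← hμ a b]
      refine (Category.assoc _ _ _).trans (congrArg (X.extι Sum.inl a b ≫ ·) ?_)
      exact NatTrans.congr_app sq.fac_left (edge (Sum.inl a) (Sum.inl b))
    · refine hom_ext' (X := hG.flow hQ.isSeparating) (Y := B) (o := fun a => p.obj (h a))
        fun a b => ?_
      exact NatTrans.congr_app sq.fac_right (edge a b)

end Factorization

end EnrSemicat

theorem isWeakFactorizationSystem_IglC (P : ObjectProperty TopCat.{u})
    [CartesianMonoidalCategory P.FullSubcategory] [MonoidalClosed P.FullSubcategory]
    [IsLocallyPresentable.{u} P.FullSubcategory]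
    (hS : ∀ n, P (TopCat.diskBoundary n)) (hD : ∀ n, P (TopCat.disk n)) :
    (IglC P hS hD).rlp.llp.IsWeakFactorizationSystem (IglC P hS hD).rlp where
  rlp := MorphismProperty.rlp_llp_rlp _
  llp := rfl
  hasFactorization := ⟨fun f => by
    obtain ⟨Z, j, q, fac, hq, hj⟩ := EnrSemicat.exists_factorization (sphereIncl P hS hD) f
    exact ⟨⟨Z, j, q, fac, fun _ _ p hp => hj p ((rlp_IglC_iff P hS hD p).1 hp).1
      ((rlp_IglC_iff P hS hD p).1 hp).2, (rlp_IglC_iff P hS hD q).2 hq⟩⟩⟩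

theorem isSmall_IglC (P : ObjectProperty TopCat.{u})
    [CartesianMonoidalCategory P.FullSubcategory] [MonoidalClosed P.FullSubcategory]
    [IsLocallyPresentable.{u} P.FullSubcategory]
    (hS : ∀ n, P (TopCat.diskBoundary n)) (hD : ∀ n, P (TopCat.disk n)) :
    MorphismProperty.IsSmall.{u} (IglC P hS hD) :=
  @isSmall_sup _ _ _ _ (MorphismProperty.isSmall_ofHoms _) (MorphismProperty.isSmall_ofHoms _)

end

theorem proposition3p2 (P : ObjectProperty TopCat.{u})
    [CartesianMonoidalCategory P.FullSubcategory] [MonoidalClosed P.FullSubcategory]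
    [IsLocallyPresentable.{u} P.FullSubcategory]
    (hS : ∀ n, P (TopCat.diskBoundary n)) (hD : ∀ n, P (TopCat.disk n)) :
    MorphismProperty.IsSmall.{u} (IglC P hS hD) ∧
    IsLeftLifting (addId P.FullSubcategory) (iliasCof P hS hD)
      (IglC P hS hD).rlp.llp (IglC P hS hD).rlp ∧
    (iliasCof P hS hD).inverseImage (addId P.FullSubcategory) = (IglC P hS hD).rlp.llp := by
  exact ⟨isSmall_IglC P hS hD, ⟨(inverseImage_iliasCof P hS hD).symm,
    isWeakFactorizationSystem_IglC P hS hD⟩, inverseImage_iliasCof P hS hD⟩
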